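/- Let $M_n$ denote a random $n\times n$ real matrix whose $n^2$ entries are independent and take the values $1$ and $-1$ with probability $1/2$ each. (i) There is a sequence $\varepsilon_n\to 0$ such that for every $n$ and every fixed real $n\times n$ matrix $C$, $$\mathbb P\left(M_nM_n^T=M_n^TM_n+C\right)\le 2^{-(0.302+\varepsilon_n)n^2}.$$ (ii) Let $\nu_n:=\mathbb P(M_nM_n^T=M_n^TM_n)$ be the probability that $M_n$ is normal. There are sequences $\varepsilon_n'\to 0$ and $\varepsilon_n''\to 0$ such that for every $n$, $$2^{-(0.5+\varepsilon_n')n^2}\le \nu_n\le 2^{-(0.302+\varepsilon_n'')n^2}.$$ -/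

import Mathlib

open Filter Topology MeasureTheory ProbabilityTheory
open scoped Matrix

/-- The Rademacher distribution on the reals: the values 1 and -1 have probability 1/2 each. -/
noncomputable def rademacherLaw : Measure ℝ :=
  (2⁻¹ : ENNReal) • Measure.dirac (1 : ℝ) + (2⁻¹ : ENNReal) • Measure.dirac (-1 : ℝ)

/-- A random `n × n` real matrix `M`, defined on a space `Ω` with measure `μ`, is a Rademacher
matrix if its `n ^ 2` entries are jointly independent and each has the Rademacher distribution. -/
structure IsRademacherMatrix {Ω : Type*} [MeasurableSpace Ω] {n : ℕ}
    (M : Ω → Matrix (Fin n) (Fin n) ℝ) (μ : Measure Ω) : Prop where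
  indep : iIndepFun (fun (p : Fin n × Fin n) (ω : Ω) => M ω p.1 p.2) μ
  law : ∀ i j : Fin n, HasLaw (fun ω => M ω i j) rademacherLaw μ

/-!
The rows of the `n × 2n` matrix `W = (M | Mᵀ)` have prescribed products for a form of signature
`(n, n)`. Reveal `M` in crosses consisting of a row and the column with the same index. The unknown
entries of the next cross satisfy one linear equation for each cross already revealed, and the rank
of this system is the rank of a block of `W`. By Odlyzko's lemma an affine space of dimension `d`
contains at most `2 ^ d` sign vectors, so a high rank makes the next cross cheap.

Choose a set `P` of indices for which the block of `W` with rows `P` and with columns outside `P`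
has the maximal rank `h`, with `t = |Pᶜ|` as small as possible. Once `h` independent rows are
revealed, maximality confines each further row in `P` to their span, and each cross outside `P`
satisfies many equations. This bounds the number of solutions. Alternatively, maximality makes the
columns outside `P` cheap inside the rows `P`, and then the `P × P` block solves an equation of
the same kind, so that one can recurse. For all `h` and `t` one of the two bounds is at most
`2 ^ (0.698 n ^ 2 + o(n ^ 2))`. The union over all choices of the combinatorial data costs a factor
`2 ^ O(n log n)`. The lower bound counts symmetric matrices.
-/

section Odlyzko

variable {𝕜 J : Type*} [Field 𝕜] [Finite J]

theorem exists_determining_coords (V : Submodule 𝕜 (J → 𝕜)) :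
    ∃ I : Finset J, I.card ≤ Module.finrank 𝕜 V ∧ ∀ v ∈ V, (∀ q ∈ I, v q = 0) → v = 0 := by
  classical
  set coord : J → Module.Dual 𝕜 V := fun q => (LinearMap.proj q).comp V.subtype
  obtain ⟨κ, a, ha, hspan, hli⟩ := exists_linearIndependent' 𝕜 coord
  have : Finite κ := Finite.of_injective a ha
  have : Fintype κ := Fintype.ofFinite κ
  refine ⟨Finset.univ.image a, ?_, fun v hv h0 => ?_⟩
  · calc (Finset.univ.image a).card ≤ Fintype.card κ := Finset.card_image_le
      _ ≤ Module.finrank 𝕜 (Module.Dual 𝕜 V) := hli.fintype_card_le_finrank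
      _ = Module.finrank 𝕜 V := Subspace.dual_finrank_eq
  · have hle : Submodule.span 𝕜 (Set.range coord) ≤
        LinearMap.ker (Module.Dual.eval 𝕜 V ⟨v, hv⟩) := by
      rw [← hspan, Submodule.span_le]
      rintro _ ⟨k, rfl⟩
      exact h0 (a k) (by simp)
    funext q
    exact hle (Submodule.subset_span ⟨q, rfl⟩)

theorem card_le_two_pow_finrank (X : Finset (J → 𝕜)) (a b : J → 𝕜)
    (hX : ∀ x ∈ X, ∀ q, x q = a q ∨ x q = b q) (V : Submodule 𝕜 (J → 𝕜))
    (hV : ∀ x ∈ X, ∀ y ∈ X, x - y ∈ V) : X.card ≤ 2 ^ Module.finrank 𝕜 V := by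
  classical
  obtain ⟨I, hI, hI0⟩ := exists_determining_coords V
  have hinj : Set.InjOn (fun (x : J → 𝕜) (q : I) => decide (x q = a q)) X := by
    intro x hx y hy hxy
    refine sub_eq_zero.1 (hI0 _ (hV x hx y hy) fun q hq => sub_eq_zero.2 ?_)
    have hiff : x q = a q ↔ y q = a q := decide_eq_decide.1 (congrFun hxy ⟨q, hq⟩)
    by_cases h : x q = a q
    · rw [h, hiff.1 h]
    · rw [(hX x hx q).resolve_left h, (hX y hy q).resolve_left (mt hiff.2 h)]
  calc X.card ≤ (Finset.univ : Finset (I → Bool)).card :=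
        Finset.card_le_card_of_injOn _ (fun _ _ => Finset.mem_coe.2 (Finset.mem_univ _)) hinj
    _ = 2 ^ I.card := by simp
    _ ≤ 2 ^ Module.finrank 𝕜 V := Nat.pow_le_pow_right two_pos hI

end Odlyzko

section BlockRank

variable {α β 𝕜 : Type*} [Field 𝕜]

/-- The row space of the block `A × Q` of a matrix. -/
def rowSpace (X : Matrix α β 𝕜) (A : Finset α) (Q : Finset β) : Submodule 𝕜 (Q → 𝕜) :=
  Submodule.span 𝕜 ((fun i (q : Q) => X i q) '' A)

/-- The rank of the block `A × Q` of a matrix. -/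
noncomputable def blockRank (X : Matrix α β 𝕜) (A : Finset α) (Q : Finset β) : ℕ :=
  Module.finrank 𝕜 (rowSpace X A Q)

/-- The null space of the block `A × Q` of a matrix: the vectors orthogonal to its rows. -/
def blockKer (X : Matrix α β 𝕜) (A : Finset α) (Q : Finset β) : Submodule 𝕜 (Q → 𝕜) :=
  LinearMap.ker (X.submatrix ((↑) : A → α) ((↑) : Q → β)).mulVecLin

theorem mem_rowSpace (X : Matrix α β 𝕜) {A : Finset α} {i : α} (hi : i ∈ A) (Q : Finset β) :
    (fun q : Q => X i q) ∈ rowSpace X A Q :=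
  Submodule.subset_span ⟨i, hi, rfl⟩

theorem mem_blockKer {X : Matrix α β 𝕜} {A : Finset α} {Q : Finset β} {y : Q → 𝕜} :
    y ∈ blockKer X A Q ↔ ∀ i ∈ A, ∑ q : Q, X i q * y q = 0 := by
  rw [blockKer, LinearMap.mem_ker, funext_iff]
  exact Subtype.forall

theorem rowSpace_mono_left (X : Matrix α β 𝕜) {A A' : Finset α} (h : A ⊆ A') (Q : Finset β) :
    rowSpace X A Q ≤ rowSpace X A' Q :=
  Submodule.span_mono (Set.image_mono (Finset.coe_subset.2 h))

theorem rowSpace_congr {X Y : Matrix α β 𝕜} {A : Finset α} {Q : Finset β}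
    (h : ∀ i ∈ A, ∀ q ∈ Q, X i q = Y i q) : rowSpace X A Q = rowSpace Y A Q :=
  congrArg _ (Set.image_congr fun i hi => funext fun q => h i hi q q.2)

theorem blockRank_eq_rank_submatrix (X : Matrix α β 𝕜) (A : Finset α) (Q : Finset β) :
    blockRank X A Q = (X.submatrix ((↑) : A → α) ((↑) : Q → β)).rank := by
  have hrange : (fun i (q : Q) => X i q) '' A =
      Set.range (X.submatrix ((↑) : A → α) ((↑) : Q → β)).row := by
    rw [Set.image_eq_range]
    rfl
  rw [blockRank, rowSpace, Matrix.rank_eq_finrank_span_row, hrange]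

theorem blockRank_transpose (X : Matrix α β 𝕜) (A : Finset α) (Q : Finset β) :
    blockRank Xᵀ Q A = blockRank X A Q := by
  rw [blockRank_eq_rank_submatrix, blockRank_eq_rank_submatrix, ← Matrix.transpose_submatrix,
    Matrix.rank_transpose]

theorem finrank_blockKer_add_blockRank (X : Matrix α β 𝕜) (A : Finset α) (Q : Finset β) :
    Module.finrank 𝕜 (blockKer X A Q) + blockRank X A Q = Q.card := by
  rw [blockRank_eq_rank_submatrix, add_comm, blockKer, Matrix.rank,
    LinearMap.finrank_range_add_finrank_ker, Module.finrank_fintype_fun_eq_card,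
    Fintype.card_coe]

theorem blockRank_mono_left (X : Matrix α β 𝕜) {A A' : Finset α} (h : A ⊆ A') (Q : Finset β) :
    blockRank X A Q ≤ blockRank X A' Q :=
  Submodule.finrank_mono (rowSpace_mono_left X h Q)

theorem blockRank_mono (X : Matrix α β 𝕜) {A A' : Finset α} {Q Q' : Finset β} (h : A ⊆ A')
    (h' : Q ⊆ Q') : blockRank X A Q ≤ blockRank X A' Q' := by
  refine (blockRank_mono_left X h Q).trans ?_
  rw [← blockRank_transpose X, ← blockRank_transpose X]
  exact blockRank_mono_left _ h' _

theorem blockRank_le_card_left (X : Matrix α β 𝕜) (A : Finset α) (Q : Finset β) :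
    blockRank X A Q ≤ A.card := by
  classical
  rw [blockRank, rowSpace, ← Finset.coe_image]
  exact (finrank_span_finset_le_card _).trans Finset.card_image_le

theorem blockRank_le_add_card_left [DecidableEq α] (X : Matrix α β 𝕜) (A A' : Finset α)
    (Q : Finset β) : blockRank X A Q ≤ blockRank X A' Q + (A \ A').card := by
  have hle : rowSpace X A Q ≤ rowSpace X A' Q ⊔ rowSpace X (A \ A') Q := by
    rw [rowSpace, rowSpace, rowSpace, ← Submodule.span_union, ← Set.image_union,
      ← Finset.coe_union, Finset.union_sdiff_self_eq_union]
    exact Submodule.span_mono (Set.image_mono (Finset.coe_subset.2 Finset.subset_union_right))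
  calc blockRank X A Q
      ≤ Module.finrank 𝕜 ↥(rowSpace X A' Q ⊔ rowSpace X (A \ A') Q) := Submodule.finrank_mono hle
    _ ≤ blockRank X A' Q + blockRank X (A \ A') Q :=
      Submodule.finrank_add_le_finrank_add_finrank _ _
    _ ≤ blockRank X A' Q + (A \ A').card := by
      gcongr
      exact blockRank_le_card_left X (A \ A') Q

theorem blockRank_le_add_card_right [DecidableEq β] (X : Matrix α β 𝕜) (A : Finset α)
    (Q Q' : Finset β) : blockRank X A Q ≤ blockRank X A Q' + (Q \ Q').card := by
  rw [← blockRank_transpose X, ← blockRank_transpose X]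
  exact blockRank_le_add_card_left _ _ _ _

theorem exists_rows_card_eq_blockRank (X : Matrix α β 𝕜) (A : Finset α) (Q : Finset β) :
    ∃ K ⊆ A, K.card = blockRank X A Q ∧ blockRank X K Q = blockRank X A Q := by
  classical
  obtain ⟨κ, a, ha, hspan, hli⟩ := exists_linearIndependent' 𝕜 (fun (i : A) (q : Q) => X i q)
  have : Finite κ := Finite.of_injective a ha
  have : Fintype κ := Fintype.ofFinite κ
  set row : α → Q → 𝕜 := fun i q => X i q
  have hA : rowSpace X A Q = Submodule.span 𝕜 (Set.range fun k => row (a k)) := by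
    rw [rowSpace, Set.image_eq_range]
    exact hspan.symm
  have hK : rowSpace X (Finset.univ.image fun k => (a k : α)) Q = rowSpace X A Q := by
    rw [hA, rowSpace, Finset.coe_image, Finset.coe_univ, Set.image_univ, ← Set.range_comp]
    rfl
  refine ⟨Finset.univ.image fun k => (a k : α), ?_, ?_, by rw [blockRank, blockRank, hK]⟩
  · exact Finset.image_subset_iff.2 fun k _ => (a k).2
  · have hinj : Function.Injective fun k => (a k : α) := Subtype.val_injective.comp ha
    rw [Finset.card_image_of_injective _ hinj, Finset.card_univ, blockRank, hA]
    exact (finrank_span_eq_card hli).symm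

theorem exists_cols_card_eq_blockRank (X : Matrix α β 𝕜) (A : Finset α) (Q : Finset β) :
    ∃ B ⊆ Q, B.card = blockRank X A Q ∧ blockRank X A B = blockRank X A Q := by
  simpa only [blockRank_transpose] using exists_rows_card_eq_blockRank Xᵀ Q A

theorem rowSpace_eq_of_blockRank_le (X : Matrix α β 𝕜) {A A' : Finset α} (h : A ⊆ A')
    {Q : Finset β} (hrank : blockRank X A' Q ≤ blockRank X A Q) :
    rowSpace X A Q = rowSpace X A' Q :=
  Submodule.eq_of_le_of_finrank_le (rowSpace_mono_left X h Q) hrank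

end BlockRank

section Counting

variable {α β γ : Type*} [DecidableEq β] [DecidableEq γ]

theorem card_image_le_card_image_of_factors (s : Finset α) (ψ : α → β) (φ : α → γ)
    (h : ∀ x ∈ s, ∀ y ∈ s, φ x = φ y → ψ x = ψ y) : (s.image ψ).card ≤ (s.image φ).card := by
  refine Finset.card_le_card_of_forall_subsingleton (fun b c => ∃ x ∈ s, ψ x = b ∧ φ x = c)
    (fun b hb => ?_) fun c _ => ?_
  · obtain ⟨x, hx, rfl⟩ := Finset.mem_image.1 hb
    exact ⟨φ x, Finset.mem_image_of_mem φ hx, x, hx, rfl, rfl⟩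
  · rintro _ ⟨_, x, hx, rfl, hxc⟩ _ ⟨_, y, hy, rfl, hyc⟩
    exact h x hx y hy (hxc.trans hyc.symm)

theorem card_image_le_mul_card_image (s : Finset α) (ψ : α → β) (φ : α → γ) (c : ℝ)
    (hc : ∀ x ∈ s, (((s.filter fun y => φ y = φ x).image ψ).card : ℝ) ≤ c) :
    ((s.image ψ).card : ℝ) ≤ c * (s.image φ).card := by
  have hsub : s.image ψ ⊆ (s.image φ).biUnion fun b => (s.filter fun y => φ y = b).image ψ := by
    refine Finset.image_subset_iff.2 fun x hx => Finset.mem_biUnion.2 ?_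
    exact ⟨φ x, Finset.mem_image_of_mem φ hx,
      Finset.mem_image_of_mem ψ (Finset.mem_filter.2 ⟨hx, rfl⟩)⟩
  calc ((s.image ψ).card : ℝ)
      ≤ ∑ b ∈ s.image φ, (((s.filter fun y => φ y = b).image ψ).card : ℝ) := by
        exact_mod_cast (Finset.card_le_card hsub).trans Finset.card_biUnion_le
    _ ≤ ∑ _ ∈ s.image φ, c := Finset.sum_le_sum (Finset.forall_mem_image.2 hc)
    _ = c * (s.image φ).card := by rw [Finset.sum_const, nsmul_eq_mul, mul_comm]

theorem card_image_le_two_rpow_mul_card_image {𝕜 J : Type*} [Field 𝕜] [Finite J]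
    (S : Finset α) (ψ : α → β) (φ : α → γ) (v : α → J → 𝕜) (a b : J → 𝕜)
    (hv : ∀ x ∈ S, ∀ q, v x q = a q ∨ v x q = b q)
    (hψ : ∀ x ∈ S, ∀ y ∈ S, φ x = φ y → v x = v y → ψ x = ψ y) (δ : ℝ)
    (hV : ∀ x₀ ∈ S, ∃ V : Submodule 𝕜 (J → 𝕜), (Module.finrank 𝕜 V : ℝ) ≤ δ ∧
      ∀ x ∈ S, φ x = φ x₀ → v x - v x₀ ∈ V) :
    ((S.image ψ).card : ℝ) ≤ 2 ^ δ * (S.image φ).card := by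
  classical
  refine card_image_le_mul_card_image S ψ φ _ fun x₀ hx₀ => ?_
  obtain ⟨V, hVδ, hdiff⟩ := hV x₀ hx₀
  set fibre := S.filter fun y => φ y = φ x₀
  have hfibre : ∀ x ∈ fibre, x ∈ S ∧ φ x = φ x₀ := fun x hx => Finset.mem_filter.1 hx
  have hfactors : (fibre.image ψ).card ≤ (fibre.image v).card :=
    card_image_le_card_image_of_factors _ _ _ fun x hx y hy =>
      hψ x (hfibre x hx).1 y (hfibre y hy).1 ((hfibre x hx).2.trans (hfibre y hy).2.symm)
  have hodlyzko : (fibre.image v).card ≤ 2 ^ Module.finrank 𝕜 V := by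
    refine card_le_two_pow_finrank _ a b ?_ V ?_ <;> simp only [Finset.forall_mem_image]
    · exact fun x hx => hv x (hfibre x hx).1
    · intro x hx y hy
      rw [← sub_sub_sub_cancel_right (v x) (v y) (v x₀)]
      exact V.sub_mem (hdiff x (hfibre x hx).1 (hfibre x hx).2)
        (hdiff y (hfibre y hy).1 (hfibre y hy).2)
  calc ((fibre.image ψ).card : ℝ) ≤ 2 ^ Module.finrank 𝕜 V := by
        exact_mod_cast hfactors.trans hodlyzko
    _ = 2 ^ (Module.finrank 𝕜 V : ℝ) := (Real.rpow_natCast 2 _).symm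
    _ ≤ 2 ^ δ := Real.rpow_le_rpow_of_exponent_le one_le_two hVδ

theorem le_two_rpow_mul_of_insert {ι : Type*} [DecidableEq ι] (F : Finset ι → ℝ)
    (B Q : Finset ι) (a b : ℝ)
    (hF : ∀ A ⊆ Q, ∀ i ∈ Q, i ∉ A → F (insert i (B ∪ A)) ≤ 2 ^ (a + b * A.card) * F (B ∪ A)) :
    F (B ∪ Q) ≤ 2 ^ (a * Q.card + b * (Q.card * (Q.card - 1) / 2)) * F B := by
  suffices h : ∀ A ⊆ Q,
      F (B ∪ A) ≤ 2 ^ (a * A.card + b * (A.card * (A.card - 1) / 2)) * F B from h Q subset_rfl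
  intro A
  induction A using Finset.induction_on with
  | empty => simp
  | insert i A hi ih =>
    intro hA
    obtain ⟨hiQ, hAQ⟩ := Finset.insert_subset_iff.1 hA
    calc F (B ∪ insert i A) = F (insert i (B ∪ A)) := by rw [Finset.union_insert]
      _ ≤ 2 ^ (a + b * A.card) * F (B ∪ A) := hF A hAQ i hiQ hi
      _ ≤ 2 ^ (a + b * A.card) *
          (2 ^ (a * A.card + b * (A.card * (A.card - 1) / 2)) * F B) := by gcongr; exact ih hAQ
      _ = _ := by
        rw [← mul_assoc, ← Real.rpow_add two_pos, Finset.card_insert_of_notMem hi]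
        push_cast
        ring_nf

end Counting

section Reveal

variable {ι : Type*}

/-- The matrix `(M | Mᵀ)`: its column `(j, false)` is column `j` of `M`, and its column `(j, true)`
is row `j` of `M`. The commutator equation says that its rows have prescribed products for a form
of signature `(n, n)`. -/
def wide (M : Matrix ι ι ℝ) : Matrix ι (ι × Bool) ℝ :=
  Matrix.of fun i q => if q.2 then M q.1 i else M i q.1

/-- The sign of the two copies of a column of `M` in the form preserved by the commutator
equation. -/
def colSign (b : Bool) : ℝ := if b then -1 else 1

/-- The columns of `wide M` belonging to the indices in `R`, two for each index. -/
def pairs (R : Finset ι) : Finset (ι × Bool) := R ×ˢ Finset.univ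

/-- The block `A × Q` of `wide M`. -/
def block (M : Matrix ι ι ℝ) (A : Finset ι) (Q : Finset (ι × Bool)) : Matrix A Q ℝ :=
  (wide M).submatrix (↑) (↑)

open Classical in
/-- The number of different blocks `A × Q` among the matrices `wide M` with `M ∈ S`. For
`Q = univ` it counts the possibilities for the rows and columns of `M` in `A`. -/
noncomputable def blockCount (S : Finset (Matrix ι ι ℝ)) (A : Finset ι) (Q : Finset (ι × Bool)) :
    ℕ :=
  (S.image fun M => block M A Q).card

open Classical in
/-- The square matrices with entries `1` and `-1`. -/
noncomputable def signMatrices (ι : Type*) [Fintype ι] : Finset (Matrix ι ι ℝ) :=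
  Fintype.piFinset fun _ => Fintype.piFinset fun _ => {1, -1}

open Classical in
/-- The sign matrices `M` with `M * Mᵀ = Mᵀ * M + C`. -/
noncomputable def commutatorSolutions [Fintype ι] (C : Matrix ι ι ℝ) : Finset (Matrix ι ι ℝ) :=
  (signMatrices ι).filter fun M => M * Mᵀ = Mᵀ * M + C

theorem wide_apply_flip (M : Matrix ι ι ℝ) (i j : ι) (b : Bool) :
    wide M i (j, b) = wide M j (i, !b) := by
  cases b <;> rfl

theorem wide_apply_self (M : Matrix ι ι ℝ) (i : ι) (b : Bool) : wide M i (i, b) = M i i := by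
  cases b <;> rfl

theorem mem_pairs {R : Finset ι} {q : ι × Bool} : q ∈ pairs R ↔ q.1 ∈ R := by
  simp [pairs]

theorem card_pairs (R : Finset ι) : (pairs R).card = 2 * R.card := by
  rw [pairs, Finset.card_product, Finset.card_univ, Fintype.card_bool, mul_comm]

theorem pairs_mono {R R' : Finset ι} (h : R ⊆ R') : pairs R ⊆ pairs R' :=
  Finset.product_subset_product_left h

theorem block_eq_iff {M N : Matrix ι ι ℝ} {A : Finset ι} {Q : Finset (ι × Bool)} :
    block M A Q = block N A Q ↔ ∀ i ∈ A, ∀ q ∈ Q, wide M i q = wide N i q := by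
  rw [← Matrix.ext_iff, Subtype.forall]
  exact forall₂_congr fun i hi => Subtype.forall

theorem blockCount_le_one {S : Finset (Matrix ι ι ℝ)} {A : Finset ι} {Q : Finset (ι × Bool)}
    (h : A = ∅ ∨ Q = ∅) : blockCount S A Q ≤ 1 := by
  classical
  refine Finset.card_le_one.2 (Finset.forall_mem_image.2 fun M _ =>
    Finset.forall_mem_image.2 fun N _ => block_eq_iff.2 ?_)
  rcases h with rfl | rfl <;> simp

variable [Fintype ι]

theorem mem_signMatrices {M : Matrix ι ι ℝ} :
    M ∈ signMatrices ι ↔ ∀ i j, M i j = 1 ∨ M i j = -1 := by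
  classical
  refine (Fintype.mem_piFinset (f := M)).trans (forall_congr' fun i => ?_)
  simp [Fintype.mem_piFinset]

theorem mem_commutatorSolutions {C M : Matrix ι ι ℝ} :
    M ∈ commutatorSolutions C ↔ M ∈ signMatrices ι ∧ M * Mᵀ = Mᵀ * M + C := by
  simp [commutatorSolutions]

theorem commutatorSolutions_subset (C : Matrix ι ι ℝ) : commutatorSolutions C ⊆ signMatrices ι :=
  Finset.filter_subset _ _

theorem wide_eq_one_or_of_mem {M : Matrix ι ι ℝ} (hM : M ∈ signMatrices ι) (i : ι)
    (q : ι × Bool) : wide M i q = 1 ∨ wide M i q = -1 := by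
  obtain ⟨j, _ | _⟩ := q
  · exact mem_signMatrices.1 hM i j
  · exact mem_signMatrices.1 hM j i

theorem commutator_eq_iff {C M : Matrix ι ι ℝ} :
    M * Mᵀ = Mᵀ * M + C ↔
      ∀ i j, ∑ q, colSign q.2 * (wide M i q * wide M j q) = C i j := by
  have hsum : ∀ i j, ∑ q, colSign q.2 * (wide M i q * wide M j q) = (M * Mᵀ - Mᵀ * M) i j := by
    intro i j
    rw [Fintype.sum_prod_type, Matrix.sub_apply, Matrix.mul_apply, Matrix.mul_apply,
      ← Finset.sum_sub_distrib]
    refine Finset.sum_congr rfl fun l _ => ?_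
    simp [colSign, wide, neg_add_eq_sub]
  rw [← sub_eq_iff_eq_add', ← Matrix.ext_iff]
  simp only [hsum]

theorem blockCount_univ (S : Finset (Matrix ι ι ℝ)) :
    blockCount S Finset.univ Finset.univ = S.card := by
  refine Finset.card_image_of_injective _ fun M N h => ?_
  ext i j
  exact block_eq_iff.1 h i (Finset.mem_univ i) (j, false) (Finset.mem_univ _)

variable {S : Finset (Matrix ι ι ℝ)}

theorem wide_eq_of_block_eq {M N : Matrix ι ι ℝ} {A : Finset ι}
    (h : block M A Finset.univ = block N A Finset.univ) {i : ι} {q : ι × Bool}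
    (hiq : i ∈ A ∨ q.1 ∈ A) : wide M i q = wide N i q := by
  rcases hiq with hi | hq
  · exact block_eq_iff.1 h i hi q (Finset.mem_univ q)
  · rw [← Prod.mk.eta (p := q), wide_apply_flip M, wide_apply_flip N]
    exact block_eq_iff.1 h q.1 hq _ (Finset.mem_univ _)

theorem blockCount_insert_col_le [DecidableEq ι] (hS : S ⊆ signMatrices ι) (P : Finset ι)
    (Q : Finset (ι × Bool)) (q : ι × Bool) (δ : ℝ)
    (hV : ∀ M₀ ∈ S, ∃ V : Submodule ℝ (P → ℝ), (Module.finrank ℝ V : ℝ) ≤ δ ∧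
      ∀ M ∈ S, block M P Q = block M₀ P Q → (fun i : P => wide M i q) ∈ V) :
    (blockCount S P (insert q Q) : ℝ) ≤ 2 ^ δ * blockCount S P Q := by
  refine card_image_le_two_rpow_mul_card_image S _ _ (fun M (i : P) => wide M i q) 1 (-1)
    (fun M hM i => wide_eq_one_or_of_mem (hS hM) i q) (fun M _ N _ hblock hcol => ?_) δ
    fun M₀ hM₀ => ?_
  · refine block_eq_iff.2 fun i hi => (Finset.forall_mem_insert ..).2 ⟨congrFun hcol ⟨i, hi⟩, ?_⟩
    exact block_eq_iff.1 hblock i hi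
  · obtain ⟨V, hVδ, hV⟩ := hV M₀ hM₀
    exact ⟨V, hVδ, fun M hM h => V.sub_mem (hV M hM h) (hV M₀ hM₀ rfl)⟩

variable [DecidableEq ι]

theorem block_insert_eq {M N : Matrix ι ι ℝ} {A : Finset ι} {i : ι}
    (h : block M A Finset.univ = block N A Finset.univ) (hii : M i i = N i i)
    (hcross : ∀ q ∈ pairs (insert i A)ᶜ, wide M i q = wide N i q) :
    block M (insert i A) Finset.univ = block N (insert i A) Finset.univ := by
  refine block_eq_iff.2 fun k hk q _ => ?_
  rcases Finset.mem_insert.1 hk with rfl | hk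
  · by_cases hq : q.1 ∈ insert k A
    · rcases Finset.mem_insert.1 hq with hqk | hq
      · rw [← Prod.mk.eta (p := q), hqk, wide_apply_self, wide_apply_self, hii]
      · exact wide_eq_of_block_eq h (Or.inr hq)
    · exact hcross q (mem_pairs.2 (Finset.mem_compl.2 hq))
  · exact wide_eq_of_block_eq h (Or.inl hk)

-- The diagonal entry `M i i` is revealed first; it costs the factor `2 ^ 1`.
theorem blockCount_insert_le (hS : S ⊆ signMatrices ι) (A : Finset ι) (i : ι) {σ : Bool → ℝ}
    (hσ : ∀ b, σ b ≠ 0) (δ : ℝ)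
    (hV : ∀ M₀ ∈ S, ∃ V : Submodule ℝ (pairs (insert i A)ᶜ → ℝ), (Module.finrank ℝ V : ℝ) ≤ δ ∧
      ∀ M ∈ S, block M A Finset.univ = block M₀ A Finset.univ → M i i = M₀ i i →
        (fun q : pairs (insert i A)ᶜ => σ q.1.2 * (wide M i q - wide M₀ i q)) ∈ V) :
    (blockCount S (insert i A) Finset.univ : ℝ) ≤
      2 ^ (δ + 1) * blockCount S A Finset.univ := by
  classical
  set blockDiag : Matrix ι ι ℝ → Matrix A (Finset.univ : Finset (ι × Bool)) ℝ × ℝ :=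
    fun M => (block M A Finset.univ, M i i)
  have hdiag : ((S.image blockDiag).card : ℝ) ≤ 2 ^ (1 : ℝ) * blockCount S A Finset.univ := by
    refine card_image_le_two_rpow_mul_card_image S _ _ (fun M (_ : Unit) => M i i) 1 (-1)
      (fun M hM _ => mem_signMatrices.1 (hS hM) i i)
      (fun M _ N _ hblock hii => Prod.ext hblock (congrFun hii ())) 1
      fun M₀ _ => ⟨⊤, by simp, fun _ _ _ => Submodule.mem_top⟩
  have hcross : (blockCount S (insert i A) Finset.univ : ℝ) ≤
      2 ^ δ * (S.image blockDiag).card := by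
    refine card_image_le_two_rpow_mul_card_image S _ _
      (fun M (q : pairs (insert i A)ᶜ) => σ q.1.2 * wide M i q) (fun q => σ q.1.2)
      (fun q => -σ q.1.2) (fun M hM q => ?_) (fun M _ N _ hMN hcross => ?_) δ fun M₀ hM₀ => ?_
    · rcases wide_eq_one_or_of_mem (hS hM) i q with h | h <;> simp [h]
    · obtain ⟨hblock, hii⟩ := Prod.mk.inj hMN
      exact block_insert_eq hblock hii fun q hq =>
        mul_left_cancel₀ (hσ q.2) (congrFun hcross ⟨q, hq⟩)
    · obtain ⟨V, hVδ, hV⟩ := hV M₀ hM₀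
      refine ⟨V, hVδ, fun M hM h => ?_⟩
      obtain ⟨hblock, hii⟩ := Prod.mk.inj h
      rw [show (_ - _ : pairs (insert i A)ᶜ → ℝ) = _ from funext fun q => (mul_sub ..).symm]
      exact hV M hM hblock hii
  calc (blockCount S (insert i A) Finset.univ : ℝ)
      ≤ 2 ^ δ * (2 ^ (1 : ℝ) * blockCount S A Finset.univ) := hcross.trans (by gcongr)
    _ = _ := by rw [Real.rpow_add two_pos, mul_assoc]

theorem card_compl_insert {A : Finset ι} {i : ι} (hi : i ∉ A) :
    ((insert i A)ᶜ.card : ℝ) = Fintype.card ι - A.card - 1 := by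
  rw [← Finset.card_add_card_compl (insert i A), Finset.card_insert_of_notMem hi]
  push_cast
  ring

theorem blockCount_insert_le_of_rank {C : Matrix ι ι ℝ} (hS : S ⊆ commutatorSolutions C)
    {A : Finset ι} {i : ι} (hi : i ∉ A) (r : ℝ)
    (hr : ∀ M ∈ S, r ≤ blockRank (wide M) A (pairs (insert i A)ᶜ)) :
    (blockCount S (insert i A) Finset.univ : ℝ) ≤
      2 ^ (2 * ((Fintype.card ι : ℝ) - A.card - 1) - r + 1) * blockCount S A Finset.univ := by
  refine blockCount_insert_le (hS.trans (commutatorSolutions_subset C)) A i (σ := colSign)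
    (by simp [colSign]) _ fun M₀ hM₀ => ⟨blockKer (wide M₀) A (pairs (insert i A)ᶜ), ?_, ?_⟩
  · have hker : (Module.finrank ℝ (blockKer (wide M₀) A (pairs (insert i A)ᶜ)) : ℝ) +
        blockRank (wide M₀) A (pairs (insert i A)ᶜ) = 2 * (insert i A)ᶜ.card := by
      rw [← Nat.cast_add, finrank_blockKer_add_blockRank, card_pairs, Nat.cast_mul, Nat.cast_two]
    rw [← card_compl_insert hi, ← hker, add_sub_assoc]
    exact le_add_of_nonneg_right (sub_nonneg.2 (hr M₀ hM₀))
  · intro M hM hblock hii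
    rw [mem_blockKer]
    intro j hj
    have heq : ∀ N ∈ S, ∑ q, colSign q.2 * (wide N i q * wide N j q) = C i j := fun N hN =>
      commutator_eq_iff.1 (mem_commutatorSolutions.1 (hS hN)).2 i j
    have hzero : ∀ q ∉ pairs (insert i A)ᶜ,
        wide M₀ j q * (colSign q.2 * (wide M i q - wide M₀ i q)) = 0 := by
      intro q hq
      suffices wide M i q = wide M₀ i q by rw [this, sub_self, mul_zero, mul_zero]
      rw [mem_pairs, Finset.mem_compl, not_not, Finset.mem_insert] at hq
      rcases hq with hq | hq
      · rw [← Prod.mk.eta (p := q), hq, wide_apply_self, wide_apply_self, hii]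
      · exact wide_eq_of_block_eq hblock (Or.inr hq)
    calc ∑ q : pairs (insert i A)ᶜ, wide M₀ j q * (colSign q.1.2 * (wide M i q - wide M₀ i q))
        = ∑ q, wide M₀ j q * (colSign q.2 * (wide M i q - wide M₀ i q)) := by
          rw [Finset.sum_coe_sort (pairs (insert i A)ᶜ)
            fun q => wide M₀ j q * (colSign q.2 * (wide M i q - wide M₀ i q))]
          exact Finset.sum_subset (Finset.subset_univ _) fun q _ => hzero q
      _ = ∑ q, (colSign q.2 * (wide M i q * wide M j q) -
            colSign q.2 * (wide M₀ i q * wide M₀ j q)) := by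
          refine Finset.sum_congr rfl fun q _ => ?_
          rw [wide_eq_of_block_eq hblock (Or.inl hj)]
          ring
      _ = 0 := by rw [Finset.sum_sub_distrib, heq M hM, heq M₀ hM₀, sub_self]

theorem blockCount_insert_le_of_span (hS : S ⊆ signMatrices ι) {A K : Finset ι} (hKA : K ⊆ A)
    (i : ι) (hi : ∀ M ∈ S, blockRank (wide M) (insert i K) (pairs (insert i A)ᶜ) ≤
      blockRank (wide M) K (pairs (insert i A)ᶜ)) :
    (blockCount S (insert i A) Finset.univ : ℝ) ≤
      2 ^ ((K.card : ℝ) + 1) * blockCount S A Finset.univ := by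
  refine blockCount_insert_le hS A i (σ := 1) (fun _ => one_ne_zero) _ fun M₀ hM₀ =>
    ⟨rowSpace (wide M₀) K (pairs (insert i A)ᶜ), ?_, fun M hM hblock _ => ?_⟩
  · exact Nat.cast_le.2 (blockRank_le_card_left (wide M₀) K _)
  · have hmem : ∀ N ∈ S, (fun q : pairs (insert i A)ᶜ => wide N i q) ∈
        rowSpace (wide N) K (pairs (insert i A)ᶜ) := fun N hN => by
      rw [rowSpace_eq_of_blockRank_le _ (Finset.subset_insert i K) (hi N hN)]
      exact mem_rowSpace _ (Finset.mem_insert_self i K) _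
    have hspace : rowSpace (wide M) K (pairs (insert i A)ᶜ) =
        rowSpace (wide M₀) K (pairs (insert i A)ᶜ) :=
      rowSpace_congr fun k hk q _ => wide_eq_of_block_eq hblock (Or.inl (hKA hk))
    simp only [Pi.one_apply, one_mul]
    exact Submodule.sub_mem _ (hspace ▸ hmem M hM) (hmem M₀ hM₀)

end Reveal

section Certificate

variable {ι : Type*} [DecidableEq ι]

/-- For an index with exactly one column in `B`, the column in `B`. -/
def boundCol (B : Finset (ι × Bool)) (i : ι) : ι × Bool := (i, !decide ((i, false) ∈ B))

/-- For an index with exactly one column in `B`, the column not in `B`. -/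
def freeCol (B : Finset (ι × Bool)) (i : ι) : ι × Bool := (i, decide ((i, false) ∈ B))

theorem eq_boundCol_or_eq_freeCol (B : Finset (ι × Bool)) (q : ι × Bool) :
    q = boundCol B q.1 ∨ q = freeCol B q.1 := by
  obtain ⟨j, b⟩ := q
  by_cases h : (j, false) ∈ B <;> cases b <;> simp [boundCol, freeCol, h]

variable [Fintype ι]

/-- The set `P` maximizes the rank of the block `A × pairs Aᶜ` of `W` over all `A`, and it cannot
be enlarged; `K × B` is a nonsingular square block of maximal size inside `P × pairs Pᶜ`. -/
structure IsRankCertificate (W : Matrix ι (ι × Bool) ℝ) (P K : Finset ι) (B : Finset (ι × Bool)) :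
    Prop where
  rows_subset : K ⊆ P
  cols_subset : B ⊆ pairs Pᶜ
  card_eq : B.card = K.card
  rank_eq : blockRank W K B = K.card
  rank_le : ∀ A : Finset ι, blockRank W A (pairs Aᶜ) ≤ K.card
  rank_lt : ∀ i ∈ Pᶜ, blockRank W P (pairs (Pᶜ.erase i)) < K.card

/-- The indices outside `P` both of whose columns are in `B`. -/
def doubles (P : Finset ι) (B : Finset (ι × Bool)) : Finset ι :=
  Pᶜ.filter fun i => (i, false) ∈ B ∧ (i, true) ∈ B

/-- The indices outside `P` not both of whose columns are in `B`; under a rank certificate exactly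
one of the two is. -/
def singles (P : Finset ι) (B : Finset (ι × Bool)) : Finset ι :=
  Pᶜ.filter fun i => ¬((i, false) ∈ B ∧ (i, true) ∈ B)

theorem exists_isRankCertificate (W : Matrix ι (ι × Bool) ℝ) :
    ∃ P K B, IsRankCertificate W P K B := by
  set rank : Finset ι → ℕ := fun A => blockRank W A (pairs Aᶜ)
  obtain ⟨A₀, -, hA₀⟩ := Finset.exists_max_image Finset.univ rank Finset.univ_nonempty
  obtain ⟨P, hP, hPmax⟩ := Finset.exists_max_image
    (Finset.univ.filter fun A => rank A = rank A₀) Finset.card ⟨A₀, by simp⟩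
  replace hP : rank P = rank A₀ := (Finset.mem_filter.1 hP).2
  obtain ⟨K, hKP, hKcard, hKrank⟩ := exists_rows_card_eq_blockRank W P (pairs Pᶜ)
  obtain ⟨B, hBP, hBcard, hBrank⟩ := exists_cols_card_eq_blockRank W K (pairs Pᶜ)
  have hle : ∀ A, rank A ≤ K.card := fun A => by
    rw [hKcard]
    exact (hA₀ A (Finset.mem_univ A)).trans_eq hP.symm
  refine ⟨P, K, B, hKP, hBP, hBcard.trans (hKrank.trans hKcard.symm),
    hBrank.trans (hKrank.trans hKcard.symm), hle, fun i hi => ?_⟩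
  by_contra! hlt
  have hmono : blockRank W P (pairs (Pᶜ.erase i)) ≤ rank (insert i P) := by
    rw [← Finset.compl_insert]
    exact blockRank_mono_left W (Finset.subset_insert i P) _
  have hinsert : rank (insert i P) = rank A₀ :=
    ((hle _).antisymm (hlt.trans hmono)).trans (hKcard.trans hP)
  have hcard := hPmax (insert i P) (Finset.mem_filter.2 ⟨Finset.mem_univ _, hinsert⟩)
  rw [Finset.card_insert_of_notMem (Finset.mem_compl.1 hi)] at hcard
  omega

section SinglesDoubles

variable {P : Finset ι} {B : Finset (ι × Bool)} {i : ι}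

theorem singles_subset_compl : singles P B ⊆ Pᶜ := Finset.filter_subset _ _

theorem mem_of_mem_doubles (hi : i ∈ doubles P B) (b : Bool) : (i, b) ∈ B := by
  cases b
  · exact (Finset.mem_filter.1 hi).2.1
  · exact (Finset.mem_filter.1 hi).2.2

theorem notMem_doubles (hi : i ∈ singles P B) : i ∉ doubles P B := fun h =>
  (Finset.mem_filter.1 hi).2 (Finset.mem_filter.1 h).2

theorem mem_singles_or_mem_doubles (hi : i ∈ Pᶜ) : i ∈ singles P B ∨ i ∈ doubles P B := by
  simp only [singles, doubles, Finset.mem_filter, hi, true_and]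
  exact not_or_of_imp id

theorem card_singles_add_card_doubles (P : Finset ι) (B : Finset (ι × Bool)) :
    (singles P B).card + (doubles P B).card = Pᶜ.card := by
  rw [add_comm]
  exact Finset.card_filter_add_card_filter_not _

theorem freeCol_notMem (hi : i ∈ singles P B) : freeCol B i ∉ B := by
  have := (Finset.mem_filter.1 hi).2
  by_cases h : (i, false) ∈ B <;> simp_all [freeCol]

theorem eq_boundCol {q : ι × Bool} (hq : q ∈ B) (hi : q.1 ∈ singles P B) : q = boundCol B q.1 :=
  (eq_boundCol_or_eq_freeCol B q).resolve_right fun h => freeCol_notMem hi (h ▸ hq)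

end SinglesDoubles

namespace IsRankCertificate

variable {W : Matrix ι (ι × Bool) ℝ} {P K : Finset ι} {B : Finset (ι × Bool)}

theorem cols_subset_pairs (H : IsRankCertificate W P K B) {A : Finset ι} (hA : A ⊆ P) :
    B ⊆ pairs Aᶜ :=
  H.cols_subset.trans (pairs_mono (Finset.compl_subset_compl.2 hA))

theorem card_le_blockRank_rows (H : IsRankCertificate W P K B) {A : Finset ι} (hA : A ⊆ K) :
    A.card ≤ blockRank W A B := by
  have hrank := blockRank_le_add_card_left W K A B
  rw [H.rank_eq, Finset.card_sdiff_of_subset hA] at hrank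
  have := Finset.card_le_card hA
  omega

theorem card_le_blockRank_cols (H : IsRankCertificate W P K B) {Q : Finset (ι × Bool)}
    (hQ : Q ⊆ B) : Q.card ≤ blockRank W K Q := by
  have hrank := blockRank_le_add_card_right W K B Q
  rw [H.rank_eq, ← H.card_eq, Finset.card_sdiff_of_subset hQ] at hrank
  have := Finset.card_le_card hQ
  omega

theorem mem_or_mem (H : IsRankCertificate W P K B) {i : ι} (hi : i ∈ Pᶜ) :
    (i, false) ∈ B ∨ (i, true) ∈ B := by
  by_contra! hcon
  have hsub : B ⊆ pairs (Pᶜ.erase i) := by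
    rintro ⟨j, b⟩ hjb
    refine mem_pairs.2 (Finset.mem_erase.2 ⟨?_, mem_pairs.1 (H.cols_subset hjb)⟩)
    rintro rfl
    cases b
    · exact hcon.1 hjb
    · exact hcon.2 hjb
  have hlt := (blockRank_mono W H.rows_subset hsub).trans_lt (H.rank_lt i hi)
  exact hlt.ne H.rank_eq

theorem boundCol_mem (H : IsRankCertificate W P K B) {i : ι} (hi : i ∈ Pᶜ) :
    boundCol B i ∈ B := by
  have := H.mem_or_mem hi
  by_cases h : (i, false) ∈ B <;> simp_all [boundCol]

theorem cols_eq (H : IsRankCertificate W P K B) :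
    B = (singles P B).image (boundCol B) ∪ pairs (doubles P B) := by
  ext q
  simp only [Finset.mem_union, Finset.mem_image, mem_pairs]
  constructor
  · intro hq
    refine (mem_singles_or_mem_doubles (mem_pairs.1 (H.cols_subset hq))).imp_left fun hs => ?_
    exact ⟨q.1, hs, (eq_boundCol hq hs).symm⟩
  · rintro (⟨i, hi, rfl⟩ | hq)
    · exact H.boundCol_mem (singles_subset_compl hi)
    · exact mem_of_mem_doubles hq q.2

theorem pairs_compl_eq (H : IsRankCertificate W P K B) :
    pairs Pᶜ = B ∪ (singles P B).image (freeCol B) := by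
  ext q
  simp only [Finset.mem_union, Finset.mem_image, mem_pairs]
  constructor
  · intro hq
    rcases mem_singles_or_mem_doubles (B := B) hq with hs | hd
    · refine (eq_boundCol_or_eq_freeCol B q).imp (fun h => ?_) fun h => ⟨q.1, hs, h.symm⟩
      exact h ▸ H.boundCol_mem hq
    · exact Or.inl (mem_of_mem_doubles hd q.2)
  · rintro (hq | ⟨i, hi, rfl⟩)
    · exact mem_pairs.1 (H.cols_subset hq)
    · exact singles_subset_compl hi

theorem card_rows (H : IsRankCertificate W P K B) :
    (singles P B).card + 2 * (doubles P B).card = K.card := by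
  have hdisj : Disjoint ((singles P B).image (boundCol B)) (pairs (doubles P B)) := by
    refine Finset.disjoint_left.2 (Finset.forall_mem_image.2 fun i hi hd => ?_)
    exact notMem_doubles hi (mem_pairs.1 hd)
  have hinj : Function.Injective (boundCol B) := fun i j h => congrArg Prod.fst h
  calc (singles P B).card + 2 * (doubles P B).card
      = ((singles P B).image (boundCol B) ∪ pairs (doubles P B)).card := by
        rw [Finset.card_union_of_disjoint hdisj, Finset.card_image_of_injective _ hinj, card_pairs]
    _ = B.card := congrArg _ H.cols_eq.symm
    _ = K.card := H.card_eq

end IsRankCertificate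

section RevealAll

variable {C : Matrix ι ι ℝ} {S : Finset (Matrix ι ι ℝ)} {P K : Finset ι} {B : Finset (ι × Bool)}

theorem blockCount_rows_le (hS : S ⊆ commutatorSolutions C)
    (H : ∀ M ∈ S, IsRankCertificate (wide M) P K B) :
    (blockCount S K Finset.univ : ℝ) ≤
      2 ^ (2 * (Fintype.card ι : ℝ) * K.card - 3 / 2 * (K.card : ℝ) ^ 2 + K.card / 2) := by
  have hchain := le_two_rpow_mul_of_insert (fun A => (blockCount S A Finset.univ : ℝ)) ∅ K
    (2 * Fintype.card ι - 1) (-3) fun A hA i hi hiA => ?_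
  · rw [Finset.empty_union] at hchain
    refine hchain.trans ((mul_le_of_le_one_right (by positivity) ?_).trans_eq ?_)
    · exact_mod_cast blockCount_le_one (Or.inl rfl)
    · ring_nf
  · rw [Finset.empty_union]
    refine (blockCount_insert_le_of_rank hS hiA A.card fun M hM => ?_).trans_eq (by ring_nf)
    have hiP : insert i A ⊆ P :=
      (Finset.insert_subset hi hA).trans (H M hM).rows_subset
    exact_mod_cast ((H M hM).card_le_blockRank_rows hA).trans
      (blockRank_mono _ subset_rfl ((H M hM).cols_subset_pairs hiP))

theorem blockCount_union_le_of_span (hS : S ⊆ signMatrices ι)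
    (H : ∀ M ∈ S, IsRankCertificate (wide M) P K B) {Q : Finset ι} (hQ : Q ⊆ P) :
    (blockCount S (K ∪ Q) Finset.univ : ℝ) ≤
      2 ^ (((K.card : ℝ) + 1) * Q.card) * blockCount S K Finset.univ := by
  have hchain := le_two_rpow_mul_of_insert (fun A => (blockCount S A Finset.univ : ℝ)) K Q
    (K.card + 1) 0 fun A hA i hi _ => ?_
  · simpa only [zero_mul, add_zero] using hchain
  · rw [zero_mul, add_zero]
    refine blockCount_insert_le_of_span hS Finset.subset_union_left i fun M hM => ?_
    have hAP : insert i (K ∪ A) ⊆ P := Finset.insert_subset (hQ hi)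
      (Finset.union_subset (H M hM).rows_subset (hA.trans hQ))
    calc blockRank (wide M) (insert i K) (pairs (insert i (K ∪ A))ᶜ)
        ≤ blockRank (wide M) (insert i (K ∪ A)) (pairs (insert i (K ∪ A))ᶜ) :=
          blockRank_mono_left _ (Finset.insert_subset_insert i Finset.subset_union_left) _
      _ ≤ K.card := (H M hM).rank_le _
      _ = blockRank (wide M) K B := (H M hM).rank_eq.symm
      _ ≤ blockRank (wide M) K (pairs (insert i (K ∪ A))ᶜ) :=
          blockRank_mono _ subset_rfl ((H M hM).cols_subset_pairs hAP)

theorem blockCount_union_le_of_rank (hS : S ⊆ commutatorSolutions C)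
    (H : ∀ M ∈ S, IsRankCertificate (wide M) P K B) {Q R : Finset ι} (hKQ : K ⊆ Q)
    (hQR : Disjoint Q R) (hP : Q ∪ R ⊆ P) :
    (blockCount S (Q ∪ R) Finset.univ : ℝ) ≤
      2 ^ (2 * ((Fintype.card ι : ℝ) - Q.card) * R.card - (R.card : ℝ) ^ 2 - K.card * R.card) *
        blockCount S Q Finset.univ := by
  have hchain := le_two_rpow_mul_of_insert (fun A => (blockCount S A Finset.univ : ℝ)) Q R
    (2 * ((Fintype.card ι : ℝ) - Q.card) - 1 - K.card) (-2) fun A hA i hi hiA => ?_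
  · convert hchain using 3
    ring
  · have hiQA : i ∉ Q ∪ A := by
      rw [Finset.mem_union, not_or]
      exact ⟨Finset.disjoint_right.1 hQR hi, hiA⟩
    refine (blockCount_insert_le_of_rank hS hiQA K.card fun M hM => ?_).trans_eq ?_
    · have hAP : insert i (Q ∪ A) ⊆ P := (Finset.insert_subset (Finset.mem_union_right Q hi)
        (Finset.union_subset_union_right hA)).trans hP
      rw [← (H M hM).rank_eq]
      exact_mod_cast blockRank_mono (wide M) (hKQ.trans Finset.subset_union_left)
        ((H M hM).cols_subset_pairs hAP)
    · rw [Finset.card_union_of_disjoint (Finset.disjoint_of_subset_right hA hQR)]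
      push_cast
      ring_nf

theorem card_sdiff_pairs_le {A : Finset ι} (hB : B ⊆ pairs Pᶜ) (hA : A ⊆ singles P B) :
    (B \ pairs (P ∪ A)ᶜ).card ≤ A.card := by
  have hsub : B \ pairs (P ∪ A)ᶜ ⊆ A.image (boundCol B) := by
    intro q hq
    simp only [Finset.mem_sdiff, mem_pairs, Finset.mem_compl, not_not, Finset.mem_union] at hq
    have hqA : q.1 ∈ A := hq.2.resolve_left (Finset.mem_compl.1 (mem_pairs.1 (hB hq.1)))
    exact Finset.mem_image.2 ⟨q.1, hqA, (eq_boundCol hq.1 (hA hqA)).symm⟩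
  exact (Finset.card_le_card hsub).trans Finset.card_image_le

theorem blockCount_union_singles_le (hS : S ⊆ commutatorSolutions C)
    (H : ∀ M ∈ S, IsRankCertificate (wide M) P K B) (hne : S.Nonempty) :
    (blockCount S (P ∪ singles P B) Finset.univ : ℝ) ≤
      2 ^ (((singles P B).card : ℝ) ^ 2 / 2 + (singles P B).card / 2) *
        blockCount S P Finset.univ := by
  obtain ⟨M₀, hM₀⟩ := hne
  have hrows : ((singles P B).card : ℝ) + 2 * (doubles P B).card = K.card :=
    mod_cast (H M₀ hM₀).card_rows
  have hcard : (P.card : ℝ) + ((singles P B).card + (doubles P B).card) = Fintype.card ι := by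
    rw [← Finset.card_add_card_compl P, ← card_singles_add_card_doubles P B]
    push_cast
    ring
  have hPs : Disjoint P (singles P B) :=
    Finset.disjoint_of_subset_right singles_subset_compl disjoint_compl_right
  have hchain := le_two_rpow_mul_of_insert (fun A => (blockCount S A Finset.univ : ℝ)) P
    (singles P B) (singles P B).card (-1) fun A hA i hi hiA => ?_
  · convert hchain using 3
    ring
  · have hiPA : i ∉ P ∪ A := by
      rw [Finset.mem_union, not_or]
      exact ⟨Finset.disjoint_right.1 hPs hi, hiA⟩
    refine (blockCount_insert_le_of_rank hS hiPA (K.card - (A.card + 1)) fun M hM => ?_).trans_eq ?_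
    · have hlost := card_sdiff_pairs_le (H M hM).cols_subset (Finset.insert_subset hi hA)
      rw [Finset.union_insert, Finset.card_insert_of_notMem hiA] at hlost
      have hrank : K.card ≤ blockRank (wide M) (P ∪ A) (pairs (insert i (P ∪ A))ᶜ) +
          (A.card + 1) := by
        rw [← (H M hM).rank_eq]
        refine (blockRank_le_add_card_right _ _ _ (pairs (insert i (P ∪ A))ᶜ)).trans ?_
        exact add_le_add (blockRank_mono_left _
          ((H M hM).rows_subset.trans Finset.subset_union_left) _) hlost
      rw [sub_le_iff_le_add]
      exact_mod_cast hrank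
    · rw [Finset.card_union_of_disjoint (Finset.disjoint_of_subset_right hA hPs), ← hrows, ← hcard]
      push_cast
      ring_nf

theorem card_le_blockCount_union_singles (hS : S ⊆ commutatorSolutions C)
    (H : ∀ M ∈ S, IsRankCertificate (wide M) P K B) :
    (S.card : ℝ) ≤ 2 ^ ((doubles P B).card : ℝ) *
      blockCount S (P ∪ singles P B) Finset.univ := by
  set Q := P ∪ singles P B with hQdef
  have hQ : ∀ j, j ∉ Q ↔ j ∈ doubles P B := by
    intro j
    simp only [hQdef, doubles, singles, Finset.mem_union, Finset.mem_filter, Finset.mem_compl]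
    tauto
  have huniv : Q ∪ doubles P B = Finset.univ :=
    Finset.eq_univ_of_forall fun j => Finset.mem_union.2 (or_iff_not_imp_left.2 (hQ j).1)
  have hchain := le_two_rpow_mul_of_insert (fun A => (blockCount S A Finset.univ : ℝ)) Q
    (doubles P B) 1 0 fun A _ i hi hiA => ?_
  · simpa only [huniv, blockCount_univ, one_mul, zero_mul, add_zero] using hchain
  · have hiQA : i ∉ Q ∪ A := by
      rw [Finset.mem_union, not_or]
      exact ⟨(hQ i).2 hi, hiA⟩
    set R := (insert i (Q ∪ A))ᶜ
    refine (blockCount_insert_le_of_rank hS hiQA (2 * R.card) fun M hM => ?_).trans_eq ?_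
    · have hRB : pairs R ⊆ B := fun q hq => by
        have hq' : q.1 ∉ insert i (Q ∪ A) := Finset.mem_compl.1 (mem_pairs.1 hq)
        refine mem_of_mem_doubles ((hQ q.1).1 fun h => hq' ?_) q.2
        exact Finset.mem_insert_of_mem (Finset.mem_union_left A h)
      have hKQA : K ⊆ Q ∪ A :=
        (H M hM).rows_subset.trans (Finset.subset_union_left.trans Finset.subset_union_left)
      have hrank := ((H M hM).card_le_blockRank_cols hRB).trans
        (blockRank_mono_left (wide M) hKQA (pairs R))
      rw [card_pairs] at hrank
      exact_mod_cast hrank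
    · rw [card_compl_insert hiQA, zero_mul, add_zero, sub_self, zero_add]

theorem card_le_blockCount_rows (hS : S ⊆ commutatorSolutions C)
    (H : ∀ M ∈ S, IsRankCertificate (wide M) P K B) (hne : S.Nonempty) :
    (S.card : ℝ) ≤
      2 ^ ((2 * (Pᶜ.card : ℝ) - K.card) ^ 2 / 2 + K.card / 2) * blockCount S P Finset.univ := by
  obtain ⟨M₀, hM₀⟩ := hne
  have ht : ((singles P B).card : ℝ) + (doubles P B).card = Pᶜ.card :=
    mod_cast card_singles_add_card_doubles P B
  have hh : ((singles P B).card : ℝ) + 2 * (doubles P B).card = K.card :=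
    mod_cast (H M₀ hM₀).card_rows
  refine (card_le_blockCount_union_singles hS H).trans
    ((mul_le_mul_of_nonneg_left (blockCount_union_singles_le hS H ⟨M₀, hM₀⟩)
      (by positivity)).trans_eq ?_)
  rw [← mul_assoc, ← Real.rpow_add two_pos, ← ht, ← hh]
  ring_nf

theorem blockCount_maximal_rows_le (hS : S ⊆ commutatorSolutions C)
    (H : ∀ M ∈ S, IsRankCertificate (wide M) P K B) (hne : S.Nonempty) {n h r : ℝ} {x : ℕ}
    (hn : Fintype.card ι = n) (hh : K.card = h) (hr : P.card = h + x + r) (hr0 : 0 ≤ r) :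
    (blockCount S P Finset.univ : ℝ) ≤ 2 ^ (2 * n * h - 3 / 2 * h ^ 2 + h / 2 + (h + 1) * x +
      (2 * (n - (h + x)) * r - r ^ 2 - h * r)) := by
  obtain ⟨M₀, hM₀⟩ := hne
  have hKP := (H M₀ hM₀).rows_subset
  have hx : K.card + x ≤ P.card := by
    rw [← @Nat.cast_le ℝ, hr, Nat.cast_add, hh]
    linarith
  obtain ⟨Q, hQ, hQcard⟩ := Finset.exists_subset_card_eq
    (show x ≤ (P \ K).card by rw [Finset.card_sdiff_of_subset hKP]; omega)
  have hKQP : K ∪ Q ⊆ P := Finset.union_subset hKP (hQ.trans Finset.sdiff_subset)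
  have hKQcard : ((K ∪ Q).card : ℝ) = h + x := by
    rw [Finset.card_union_of_disjoint (Finset.disjoint_of_subset_right hQ Finset.disjoint_sdiff),
      hQcard, Nat.cast_add, hh]
  have hRcard : ((P \ (K ∪ Q)).card : ℝ) = r := by
    rw [Finset.card_sdiff_of_subset hKQP, Nat.cast_sub (Finset.card_le_card hKQP), hr, hKQcard]
    ring
  have hrank := blockCount_union_le_of_rank hS H (R := P \ (K ∪ Q))
    Finset.subset_union_left Finset.disjoint_sdiff (Finset.union_sdiff_of_subset hKQP).subset
  have hspan := blockCount_union_le_of_span (hS.trans (commutatorSolutions_subset C)) H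
    (hQ.trans Finset.sdiff_subset)
  have hrows := blockCount_rows_le hS H
  rw [Finset.union_sdiff_of_subset hKQP, hKQcard, hRcard, hn, hh] at hrank
  rw [hh, hQcard] at hspan
  rw [hn, hh] at hrows
  refine hrank.trans ((mul_le_mul_of_nonneg_left (hspan.trans
    (mul_le_mul_of_nonneg_left hrows (by positivity))) (by positivity)).trans_eq ?_)
  rw [← Real.rpow_add two_pos, ← Real.rpow_add two_pos]
  ring_nf

theorem card_le_of_reveal (hS : S ⊆ commutatorSolutions C)
    (H : ∀ M ∈ S, IsRankCertificate (wide M) P K B) (hne : S.Nonempty) {n h t : ℝ}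
    (hn : Fintype.card ι = n) (hh : K.card = h) (ht : Pᶜ.card = t) {x : ℕ}
    (hx : K.card + x ≤ P.card) :
    (S.card : ℝ) ≤
      2 ^ (n ^ 2 - h * n + h ^ 2 + t ^ 2 - h * t + x ^ 2 - 2 * (n - 2 * h) * x + n) := by
  have hxP : h + x ≤ P.card := by
    rw [← hh]
    exact_mod_cast hx
  have hP : P.card + t = n := by
    rw [← hn, ← ht]
    exact_mod_cast Finset.card_add_card_compl P
  have hrows := blockCount_maximal_rows_le hS H hne hn hh
    (add_sub_cancel (h + x) (P.card : ℝ)).symm (sub_nonneg.2 hxP)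
  have ht0 : 0 ≤ t := ht ▸ Nat.cast_nonneg _
  refine (card_le_blockCount_rows hS H hne).trans
    ((mul_le_mul_of_nonneg_left hrows (by positivity)).trans ?_)
  rw [← Real.rpow_add two_pos, ht, hh, eq_sub_of_add_eq hP]
  exact Real.rpow_le_rpow_of_exponent_le one_le_two (by nlinarith [ht0])

end RevealAll

end Certificate

section ColumnSpace

variable {ι κ : Type*}

/-- Column `q` of `W`, restricted to the rows in `P`. -/
def colVec (W : Matrix ι κ ℝ) (P : Finset ι) (q : κ) : P → ℝ := fun i => W i q

/-- The span of the columns in `Q` of `W`, restricted to the rows in `P`. -/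
def colSpace (W : Matrix ι κ ℝ) (P : Finset ι) (Q : Finset κ) : Submodule ℝ (P → ℝ) :=
  Submodule.span ℝ (colVec W P '' Q)

/-- Coefficients that express `v` through the vectors `c b` with `b ∈ B`. They are junk if `v` is
not in the span; in any case they are determined by `v` and the values of `c` on `B`. -/
noncomputable def spanCoeff {E : Type*} [AddCommMonoid E] [Module ℝ E] (B : Finset κ) (c : κ → E)
    (v : E) : κ → ℝ :=
  Classical.epsilon fun γ => ∑ b ∈ B, γ b • c b = v

theorem spanCoeff_congr {E : Type*} [AddCommMonoid E] [Module ℝ E] {B : Finset κ} {c c' : κ → E}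
    (h : ∀ b ∈ B, c b = c' b) (v : E) : spanCoeff B c v = spanCoeff B c' v := by
  refine congrArg _ (funext fun γ => ?_)
  rw [Finset.sum_congr rfl fun b hb => by rw [h b hb]]

theorem sum_spanCoeff_smul {E : Type*} [AddCommMonoid E] [Module ℝ E] {B : Finset κ} {c : κ → E}
    {v : E} (hv : v ∈ Submodule.span ℝ (c '' B)) : ∑ b ∈ B, spanCoeff B c v b • c b = v := by
  classical
  refine Classical.epsilon_spec (p := fun γ : κ → ℝ => ∑ b ∈ B, γ b • c b = v) ?_
  obtain ⟨γ, hγ⟩ := (Submodule.mem_span_image_finset_iff_exists_fun ℝ).1 hv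
  refine ⟨fun b => if hb : b ∈ B then γ ⟨b, hb⟩ else 0, ?_⟩
  rw [← hγ, ← Finset.sum_coe_sort]
  exact Finset.sum_congr rfl fun b _ => by simp only [Finset.coe_mem, dif_pos]

variable {W : Matrix ι κ ℝ} {P : Finset ι}

theorem colVec_mem_colSpace {Q : Finset κ} {q : κ} (hq : q ∈ Q) : colVec W P q ∈ colSpace W P Q :=
  Submodule.subset_span ⟨q, hq, rfl⟩

theorem finrank_colSpace (W : Matrix ι κ ℝ) (P : Finset ι) (Q : Finset κ) :
    Module.finrank ℝ (colSpace W P Q) = blockRank W P Q :=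
  blockRank_transpose W P Q

theorem finrank_colSpace_le_card (W : Matrix ι κ ℝ) (P : Finset ι) (Q : Finset κ) :
    Module.finrank ℝ (colSpace W P Q) ≤ Q.card :=
  blockRank_le_card_left Wᵀ Q P

theorem colSpace_mono {Q Q' : Finset κ} (h : Q ⊆ Q') : colSpace W P Q ≤ colSpace W P Q' :=
  rowSpace_mono_left Wᵀ h P

end ColumnSpace

section PairPart

theorem colVec_eq_of_block_eq {ι : Type*} {M N : Matrix ι ι ℝ} {P : Finset ι}
    {Q : Finset (ι × Bool)} (h : block M P Q = block N P Q) {q : ι × Bool} (hq : q ∈ Q) :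
    colVec (wide M) P q = colVec (wide N) P q :=
  funext fun i => block_eq_iff.1 h i i.2 q hq

variable {ι : Type*} [DecidableEq ι]

/-- The columns of `B` that belong to the index `j`. -/
def colsAt (B : Finset (ι × Bool)) (j : ι) : Finset (ι × Bool) := B.filter fun b => b.1 = j

/-- The part of column `q`, expanded in the columns of `B`, that is carried by the columns of `B`
belonging to the index `j`. -/
noncomputable def pairPart (W : Matrix ι (ι × Bool) ℝ) (P : Finset ι) (B : Finset (ι × Bool))
    (q : ι × Bool) (j : ι) : P → ℝ :=
  ∑ b ∈ colsAt B j, spanCoeff B (colVec W P) (colVec W P q) b • colVec W P b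

variable {W W' : Matrix ι (ι × Bool) ℝ} {P K : Finset ι} {B : Finset (ι × Bool)}

theorem pairPart_congr (hB : ∀ b ∈ B, colVec W P b = colVec W' P b) {q : ι × Bool}
    (hq : colVec W P q = colVec W' P q) (j : ι) : pairPart W P B q j = pairPart W' P B q j := by
  rw [pairPart, pairPart, spanCoeff_congr hB, hq]
  exact Finset.sum_congr rfl fun b hb => by rw [hB b (Finset.mem_filter.1 hb).1]

theorem pairPart_mem_colSpace (q : ι × Bool) (j : ι) :
    pairPart W P B q j ∈ colSpace W P (colsAt B j) :=
  Submodule.sum_mem _ fun _ hb => Submodule.smul_mem _ _ (colVec_mem_colSpace hb)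

theorem colsAt_subset_pairs (B : Finset (ι × Bool)) (j : ι) : colsAt B j ⊆ pairs {j} := fun _ hb =>
  mem_pairs.2 (Finset.mem_singleton.2 (Finset.mem_filter.1 hb).2)

variable [Fintype ι]

theorem colsAt_subset_singleton {i : ι} (hi : i ∈ singles P B) : colsAt B i ⊆ {boundCol B i} := by
  intro b hb
  obtain ⟨hbB, rfl⟩ := Finset.mem_filter.1 hb
  exact Finset.mem_singleton.2 (eq_boundCol hbB hi)

namespace IsRankCertificate

theorem finrank_colSpace_cols (H : IsRankCertificate W P K B) :
    Module.finrank ℝ (colSpace W P B) = K.card := by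
  refine ((finrank_colSpace_le_card W P B).trans_eq H.card_eq).antisymm ?_
  rw [finrank_colSpace, ← H.rank_eq]
  exact blockRank_mono_left W H.rows_subset B

theorem sum_pairPart (H : IsRankCertificate W P K B) {q : ι × Bool} (hq : q ∈ pairs Pᶜ) :
    ∑ j ∈ Pᶜ, pairPart W P B q j = colVec W P q := by
  have hspace : colSpace W P B = colSpace W P (pairs Pᶜ) := by
    refine Submodule.eq_of_le_of_finrank_le (colSpace_mono H.cols_subset) ?_
    rw [H.finrank_colSpace_cols, finrank_colSpace]
    exact H.rank_le P
  have hmem : colVec W P q ∈ colSpace W P B := hspace ▸ colVec_mem_colSpace hq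
  exact (Finset.sum_fiberwise_of_maps_to (fun b hb => mem_pairs.1 (H.cols_subset hb)) _).trans
    (sum_spanCoeff_smul hmem)

theorem pairPart_mem_colSpace_erase (H : IsRankCertificate W P K B) {q : ι × Bool}
    (hq : q ∈ pairs Pᶜ) {j : ι} (hj : j ∈ Pᶜ) (hqj : q.1 ≠ j) :
    pairPart W P B q j ∈ colSpace W P (pairs (Pᶜ.erase j)) := by
  have hmem : ∀ b ∈ pairs Pᶜ, b.1 ≠ j → colVec W P b ∈ colSpace W P (pairs (Pᶜ.erase j)) :=
    fun b hb hbj => colVec_mem_colSpace (mem_pairs.2 (Finset.mem_erase.2 ⟨hbj, mem_pairs.1 hb⟩))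
  rw [eq_sub_of_add_eq ((Finset.add_sum_erase _ _ hj).trans (H.sum_pairPart hq))]
  refine Submodule.sub_mem _ (hmem q hq hqj) (Submodule.sum_mem _ fun l hl =>
    Submodule.sum_mem _ fun b hb => Submodule.smul_mem _ _ ?_)
  obtain ⟨hbB, rfl⟩ := Finset.mem_filter.1 hb
  exact hmem b (H.cols_subset hbB) (Finset.ne_of_mem_erase hl)

theorem finrank_colSpace_inf_lt (H : IsRankCertificate W P K B) {j : ι} (hj : j ∈ Pᶜ) :
    Module.finrank ℝ ↥(colSpace W P (colsAt B j) ⊓ colSpace W P (pairs (Pᶜ.erase j))) <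
      (colsAt B j).card := by
  refine (Submodule.finrank_lt_finrank_of_lt (inf_le_left.lt_of_not_ge fun hle => ?_)).trans_le
    (finrank_colSpace_le_card W P _)
  have hB : colSpace W P B ≤ colSpace W P (pairs (Pᶜ.erase j)) := by
    refine Submodule.span_le.2 (Set.image_subset_iff.2 fun b hb => ?_)
    by_cases hbj : b.1 = j
    · exact (hle.trans inf_le_right) (colVec_mem_colSpace (Finset.mem_filter.2 ⟨hb, hbj⟩))
    · exact colVec_mem_colSpace
        (mem_pairs.2 (Finset.mem_erase.2 ⟨hbj, mem_pairs.1 (H.cols_subset hb)⟩))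
  have hlt := (Submodule.finrank_mono hB).trans_lt
    ((finrank_colSpace W P _).trans_lt (H.rank_lt j hj))
  exact hlt.ne H.finrank_colSpace_cols

theorem pairPart_single_eq_zero (H : IsRankCertificate W P K B) {q : ι × Bool} (hq : q ∈ pairs Pᶜ)
    {j : ι} (hj : j ∈ singles P B) (hqj : q.1 ≠ j) : pairPart W P B q j = 0 := by
  have hjP := singles_subset_compl hj
  have hlt := (H.finrank_colSpace_inf_lt hjP).trans_le
    (Finset.card_le_card (colsAt_subset_singleton hj))
  have hbot := Submodule.finrank_eq_zero.1 (Nat.lt_one_iff.1 hlt)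
  rw [← Submodule.mem_bot ℝ, ← hbot]
  exact ⟨pairPart_mem_colSpace q j, H.pairPart_mem_colSpace_erase hq hjP hqj⟩

theorem exists_pairPart_eq_smul (H : IsRankCertificate W P K B) {q q' : ι × Bool}
    (hq : q ∈ pairs Pᶜ) (hq' : q' ∈ pairs Pᶜ) {j : ι} (hj : j ∈ Pᶜ) (hqj : q.1 ≠ j)
    (hqj' : q'.1 ≠ j) (hne : pairPart W P B q' j ≠ 0) :
    ∃ t : ℝ, t • pairPart W P B q' j = pairPart W P B q j := by
  have hmem : ∀ p ∈ pairs Pᶜ, p.1 ≠ j → pairPart W P B p j ∈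
      colSpace W P (colsAt B j) ⊓ colSpace W P (pairs (Pᶜ.erase j)) := fun p hp hpj =>
    ⟨pairPart_mem_colSpace p j, H.pairPart_mem_colSpace_erase hp hj hpj⟩
  have hlt := (H.finrank_colSpace_inf_lt hj).trans_le
    (Finset.card_le_card (colsAt_subset_pairs B j))
  rw [card_pairs, Finset.card_singleton] at hlt
  have hspan := Submodule.eq_of_le_of_finrank_le
    ((Submodule.span_singleton_le_iff_mem _ _).2 (hmem q' hq' hqj'))
    ((Nat.lt_succ_iff.1 hlt).trans_eq (finrank_span_singleton hne).symm)
  exact Submodule.mem_span_singleton.1 (hspan ▸ hmem q hq hqj)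

end IsRankCertificate

end PairPart

section FirstActive

variable {ι : Type*} [Fintype ι] [LinearOrder ι]

/-- The first single index whose free column has a nonzero part at the pair of columns of `j`; it
is `⊤` if there is no such index. -/
noncomputable def firstActive (W : Matrix ι (ι × Bool) ℝ) (P : Finset ι) (B : Finset (ι × Bool))
    (j : ι) : WithTop ι :=
  ((singles P B).filter fun i => pairPart W P B (freeCol B i) j ≠ 0).min

variable {W : Matrix ι (ι × Bool) ℝ} {P K : Finset ι} {B : Finset (ι × Bool)}

theorem exists_firstActive_eq {i j : ι} (hi : i ∈ singles P B)
    (hne : pairPart W P B (freeCol B i) j ≠ 0) :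
    ∃ i₀ ∈ singles P B, firstActive W P B j = i₀ ∧ i₀ ≤ i ∧
      pairPart W P B (freeCol B i₀) j ≠ 0 := by
  have hmem : i ∈ (singles P B).filter fun i => pairPart W P B (freeCol B i) j ≠ 0 :=
    Finset.mem_filter.2 ⟨hi, hne⟩
  obtain ⟨i₀, hi₀⟩ := Finset.min_of_mem hmem
  obtain ⟨hi₀s, hi₀ne⟩ := Finset.mem_filter.1 (Finset.mem_of_min hi₀)
  exact ⟨i₀, hi₀s, hi₀, Finset.min_le_of_eq hmem hi₀, hi₀ne⟩

theorem freeCol_mem_pairs {i : ι} (hi : i ∈ singles P B) : freeCol B i ∈ pairs Pᶜ :=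
  mem_pairs.2 (singles_subset_compl hi)

/-- The doubles for which `i` is recorded by `ν` as the first active index. -/
def activeDoubles (P : Finset ι) (B : Finset (ι × Bool)) (ν : ι → WithTop ι) (i : ι) : Finset ι :=
  (doubles P B).filter fun j => ν j = i

/-- A space that contains the free column of `i` if `ν` records the first active indices, and is
determined by the columns in `B` and the earlier free columns. A double contributes both of its
columns if `i` is its first active index. If its first active index is smaller, then it
contributes only one direction, which can be read off from that earlier free column. -/
noncomputable def freeColSpace (W : Matrix ι (ι × Bool) ℝ) (P : Finset ι) (B : Finset (ι × Bool))
    (ν : ι → WithTop ι) (i : ι) : Submodule ℝ (P → ℝ) :=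
  colSpace W P (insert (boundCol B i) (pairs (activeDoubles P B ν i))) ⊔
    Submodule.span ℝ ((fun j => pairPart W P B (freeCol B ((ν j).untopD i)) j) ''
      ((doubles P B).filter fun j => ν j < i))

theorem finrank_freeColSpace_le (W : Matrix ι (ι × Bool) ℝ) (P : Finset ι)
    (B : Finset (ι × Bool)) (ν : ι → WithTop ι) (i : ι) :
    Module.finrank ℝ (freeColSpace W P B ν i) ≤
      1 + (doubles P B).card + (activeDoubles P B ν i).card := by
  classical
  have hcols := (finrank_colSpace_le_card W P
    (insert (boundCol B i) (pairs (activeDoubles P B ν i)))).trans (Finset.card_insert_le _ _)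
  rw [card_pairs] at hcols
  have hdisj : Disjoint (activeDoubles P B ν i) ((doubles P B).filter fun j => ν j < i) :=
    Finset.disjoint_filter.2 fun j _ heq hlt => hlt.ne heq
  have hcard : (activeDoubles P B ν i).card + ((doubles P B).filter fun j => ν j < i).card ≤
      (doubles P B).card := by
    rw [← Finset.card_union_of_disjoint hdisj]
    exact Finset.card_le_card
      (Finset.union_subset (Finset.filter_subset _ _) (Finset.filter_subset _ _))
  rw [freeColSpace, ← Finset.coe_image]
  refine (Submodule.finrank_add_le_finrank_add_finrank _ _).trans ((add_le_add hcols
    ((finrank_span_finset_le_card _).trans Finset.card_image_le)).trans ?_)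
  omega

theorem freeColSpace_congr {W' : Matrix ι (ι × Bool) ℝ} (H : IsRankCertificate W P K B) {i : ι}
    (hi : i ∈ singles P B) (hB : ∀ b ∈ B, colVec W P b = colVec W' P b)
    (hfree : ∀ k ∈ singles P B, k < i → colVec W P (freeCol B k) = colVec W' P (freeCol B k)) :
    freeColSpace W P B (firstActive W P B) i = freeColSpace W' P B (firstActive W P B) i := by
  have hcols : insert (boundCol B i) (pairs (activeDoubles P B (firstActive W P B) i)) ⊆ B :=
    Finset.insert_subset (H.boundCol_mem (singles_subset_compl hi)) fun b hb =>
      mem_of_mem_doubles (Finset.mem_filter.1 (mem_pairs.1 hb)).1 b.2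
  have hpairs : ∀ j ∈ (doubles P B).filter fun j => firstActive W P B j < i,
      pairPart W P B (freeCol B ((firstActive W P B j).untopD i)) j =
        pairPart W' P B (freeCol B ((firstActive W P B j).untopD i)) j := by
    intro j hj
    have hlt : firstActive W P B j < i := (Finset.mem_filter.1 hj).2
    obtain ⟨i₀, hi₀⟩ := WithTop.ne_top_iff_exists.1 (hlt.trans (WithTop.coe_lt_top i)).ne
    rw [← hi₀, WithTop.coe_lt_coe] at hlt
    rw [← hi₀, WithTop.untopD_coe]
    exact pairPart_congr hB (hfree i₀ (Finset.mem_filter.1 (Finset.mem_of_min hi₀.symm)).1 hlt) j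
  rw [freeColSpace, freeColSpace, colSpace, colSpace, Set.image_congr hpairs,
    Set.image_congr fun b hb => hB b (hcols hb)]

theorem IsRankCertificate.colVec_freeCol_mem (H : IsRankCertificate W P K B) {i : ι}
    (hi : i ∈ singles P B) :
    colVec W P (freeCol B i) ∈ freeColSpace W P B (firstActive W P B) i := by
  rw [← H.sum_pairPart (freeCol_mem_pairs hi)]
  refine Submodule.sum_mem _ fun j hj => ?_
  by_cases hzero : pairPart W P B (freeCol B i) j = 0
  · exact hzero ▸ Submodule.zero_mem _
  rcases mem_singles_or_mem_doubles (B := B) hj with hjs | hjd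
  · obtain rfl : i = j := by_contra fun hij =>
      hzero (H.pairPart_single_eq_zero (freeCol_mem_pairs hi) hjs hij)
    refine Submodule.mem_sup_left (colSpace_mono ?_ (pairPart_mem_colSpace _ _))
    exact (colsAt_subset_singleton hi).trans
      (Finset.singleton_subset_iff.2 (Finset.mem_insert_self _ _))
  obtain ⟨i₀, hi₀, hν, hle, hne⟩ := exists_firstActive_eq hi hzero
  have hij : ∀ k ∈ singles P B, k ≠ j := fun k hk h => notMem_doubles hk (h ▸ hjd)
  by_cases hi₀i : i₀ = i
  · subst hi₀i
    refine Submodule.mem_sup_left (colSpace_mono ?_ (pairPart_mem_colSpace _ _))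
    have hja : {j} ⊆ activeDoubles P B (firstActive W P B) i₀ :=
      Finset.singleton_subset_iff.2 (Finset.mem_filter.2 ⟨hjd, hν⟩)
    exact (colsAt_subset_pairs B j).trans ((pairs_mono hja).trans (Finset.subset_insert _ _))
  · obtain ⟨t, ht⟩ := H.exists_pairPart_eq_smul (freeCol_mem_pairs hi) (freeCol_mem_pairs hi₀) hj
      (hij i hi) (hij i₀ hi₀) hne
    rw [← ht]
    refine Submodule.mem_sup_right (Submodule.smul_mem _ t (Submodule.subset_span ⟨j, ?_, ?_⟩))
    · exact Finset.mem_filter.2 ⟨hjd, hν.trans_lt (WithTop.coe_lt_coe.2 (hle.lt_of_ne hi₀i))⟩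
    · simp only [hν, WithTop.untopD_coe]

variable {S : Finset (Matrix ι ι ℝ)} {ν : ι → WithTop ι}

theorem blockCount_cols_le (hS : S ⊆ signMatrices ι) (P : Finset ι) (B : Finset (ι × Bool)) :
    (blockCount S P B : ℝ) ≤ 2 ^ ((P.card : ℝ) * B.card) := by
  have hchain := le_two_rpow_mul_of_insert (fun Q => (blockCount S P Q : ℝ)) ∅ B P.card 0
    fun Q _ q _ _ => ?_
  · rw [Finset.empty_union, zero_mul, add_zero] at hchain
    refine hchain.trans (mul_le_of_le_one_right (by positivity) ?_)
    exact_mod_cast blockCount_le_one (Or.inr rfl)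
  · rw [zero_mul, add_zero]
    refine blockCount_insert_col_le hS P _ q _ fun _ _ => ⟨⊤, ?_, fun _ _ _ => trivial⟩
    rw [finrank_top, Module.finrank_fintype_fun_eq_card, Fintype.card_coe]

theorem blockCount_insert_freeCol_le (hS : S ⊆ signMatrices ι)
    (H : ∀ M ∈ S, IsRankCertificate (wide M) P K B)
    (hν : ∀ M ∈ S, firstActive (wide M) P B = ν) {i : ι} (hi : i ∈ singles P B) {A : Finset ι}
    (hA : ∀ k ∈ singles P B, k < i → k ∈ A) :
    (blockCount S P (insert (freeCol B i) (B ∪ A.image (freeCol B))) : ℝ) ≤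
      2 ^ (1 + ((doubles P B).card : ℝ) + (activeDoubles P B ν i).card) *
        blockCount S P (B ∪ A.image (freeCol B)) := by
  refine blockCount_insert_col_le hS P _ _ _ fun M₀ _ =>
    ⟨freeColSpace (wide M₀) P B ν i, ?_, fun M hM hblock => ?_⟩
  · exact_mod_cast finrank_freeColSpace_le (wide M₀) P B ν i
  · have hmem := (H M hM).colVec_freeCol_mem hi
    rwa [freeColSpace_congr (H M hM) hi
      (fun b hb => colVec_eq_of_block_eq hblock (Finset.mem_union_left _ hb))
      (fun k hk hki => colVec_eq_of_block_eq hblock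
        (Finset.mem_union_right _ (Finset.mem_image_of_mem _ (hA k hk hki)))), hν M hM] at hmem

theorem blockCount_union_freeCol_le (hS : S ⊆ signMatrices ι)
    (H : ∀ M ∈ S, IsRankCertificate (wide M) P K B)
    (hν : ∀ M ∈ S, firstActive (wide M) P B = ν) {A : Finset ι} (hA : A ⊆ singles P B)
    (hlower : ∀ k ∈ singles P B, ∀ i ∈ A, k < i → k ∈ A) :
    (blockCount S P (B ∪ A.image (freeCol B)) : ℝ) ≤
      2 ^ (∑ i ∈ A, (1 + ((doubles P B).card : ℝ) + (activeDoubles P B ν i).card)) *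
        blockCount S P B := by
  induction A using Finset.induction_on_max with
  | empty => simp
  | insert i A hmax ih =>
    have hiA : i ∉ A := fun h => lt_irrefl i (hmax i h)
    obtain ⟨hi, hA⟩ := Finset.insert_subset_iff.1 hA
    have hbelow : ∀ k ∈ singles P B, k < i → k ∈ A := fun k hk hki =>
      (Finset.mem_insert.1 (hlower k hk i (Finset.mem_insert_self i A) hki)).resolve_left hki.ne
    have ih := ih hA fun k hk l hl hkl => hbelow k hk (hkl.trans (hmax l hl))
    rw [Finset.image_insert, Finset.union_insert, Finset.sum_insert hiA, Real.rpow_add two_pos,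
      mul_assoc]
    exact (blockCount_insert_freeCol_le hS H hν hi hbelow).trans
      (mul_le_mul_of_nonneg_left ih (by positivity))

theorem sum_card_activeDoubles_le (P : Finset ι) (B : Finset (ι × Bool)) (ν : ι → WithTop ι)
    (A : Finset ι) : ∑ i ∈ A, (activeDoubles P B ν i).card ≤ (doubles P B).card := by
  have hdisj : ∀ i ∈ A, ∀ k ∈ A, i ≠ k →
      Disjoint (activeDoubles P B ν i) (activeDoubles P B ν k) := fun i _ k _ hik =>
    Finset.disjoint_filter.2 fun j _ hi hk => hik (WithTop.coe_injective (hi.symm.trans hk))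
  rw [← Finset.card_biUnion hdisj]
  exact Finset.card_le_card (Finset.biUnion_subset.2 fun i _ => Finset.filter_subset _ _)

theorem blockCount_outer_cols_le (hS : S ⊆ signMatrices ι)
    (H : ∀ M ∈ S, IsRankCertificate (wide M) P K B)
    (hν : ∀ M ∈ S, firstActive (wide M) P B = ν) (hne : S.Nonempty) :
    (blockCount S P (pairs Pᶜ) : ℝ) ≤
      2 ^ ((P.card : ℝ) * K.card + (singles P B).card * (1 + (doubles P B).card) +
        (doubles P B).card) := by
  obtain ⟨M₀, hM₀⟩ := hne
  have hcols := blockCount_cols_le hS P B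
  rw [(H M₀ hM₀).card_eq] at hcols
  have hfree := blockCount_union_freeCol_le hS H hν subset_rfl fun k hk _ _ _ => hk
  have hactive : (∑ i ∈ singles P B, ((activeDoubles P B ν i).card : ℝ)) ≤ (doubles P B).card :=
    mod_cast sum_card_activeDoubles_le P B ν (singles P B)
  rw [Finset.sum_add_distrib, Finset.sum_const, nsmul_eq_mul, ← (H M₀ hM₀).pairs_compl_eq] at hfree
  refine hfree.trans ((mul_le_mul_of_nonneg_left hcols (by positivity)).trans ?_)
  rw [← Real.rpow_add two_pos]
  exact Real.rpow_le_rpow_of_exponent_le one_le_two (by linarith)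

end FirstActive

section Recursion

variable {ι : Type*}

theorem sum_pairs {β : Type*} [AddCommMonoid β] (P : Finset ι) (f : ι × Bool → β) :
    ∑ q ∈ pairs P, f q = ∑ q : P × Bool, f (q.1, q.2) := by
  rw [pairs, Finset.sum_product, Fintype.sum_prod_type]
  exact (Finset.sum_coe_sort P _).symm

variable [Fintype ι] [DecidableEq ι]

theorem block_univ_eq {M N : Matrix ι ι ℝ} {P : Finset ι}
    (houter : block M P (pairs Pᶜ) = block N P (pairs Pᶜ))
    (hinner : (M.submatrix (↑) (↑) : Matrix P P ℝ) = N.submatrix (↑) (↑)) :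
    block M P Finset.univ = block N P Finset.univ := by
  refine block_eq_iff.2 fun i hi q _ => ?_
  by_cases hq : q.1 ∈ P
  · obtain ⟨j, _ | _⟩ := q
    · exact congrFun₂ hinner ⟨i, hi⟩ ⟨j, hq⟩
    · exact congrFun₂ hinner ⟨j, hq⟩ ⟨i, hi⟩
  · exact block_eq_iff.1 houter i hi q (mem_pairs.2 (Finset.mem_compl.2 hq))

theorem submatrix_mem_commutatorSolutions {C M : Matrix ι ι ℝ} (hM : M ∈ commutatorSolutions C)
    (P : Finset ι) :
    M.submatrix (↑) (↑) ∈ commutatorSolutions (Matrix.of fun i j : P =>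
      C i j - ∑ q ∈ pairs Pᶜ, colSign q.2 * (wide M i q * wide M j q)) := by
  obtain ⟨hsign, hcomm⟩ := mem_commutatorSolutions.1 hM
  refine mem_commutatorSolutions.2 ⟨mem_signMatrices.2 fun i j => mem_signMatrices.1 hsign i j,
    commutator_eq_iff.2 fun i j => eq_sub_of_add_eq ?_⟩
  rw [← commutator_eq_iff.1 hcomm i j, ← Finset.sum_add_sum_compl (pairs P)]
  have hcompl : (pairs P)ᶜ = pairs Pᶜ := by
    ext q
    rw [Finset.mem_compl, mem_pairs, mem_pairs, Finset.mem_compl]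
  rw [hcompl, sum_pairs P]
  rfl

variable {C : Matrix ι ι ℝ} {S : Finset (Matrix ι ι ℝ)}

theorem blockCount_univ_le_mul (hS : S ⊆ commutatorSolutions C) (P : Finset ι) {N : ℝ}
    (hN : ∀ C' : Matrix P P ℝ, ((commutatorSolutions C').card : ℝ) ≤ N) :
    (blockCount S P Finset.univ : ℝ) ≤ N * blockCount S P (pairs Pᶜ) := by
  classical
  refine card_image_le_mul_card_image _ _ _ N fun M₀ _ => ?_
  set fiber := S.filter fun M => block M P (pairs Pᶜ) = block M₀ P (pairs Pᶜ)
  set inner : Matrix ι ι ℝ → Matrix P P ℝ := fun M => M.submatrix (↑) (↑)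
  set C' : Matrix P P ℝ := Matrix.of fun i j =>
    C i j - ∑ q ∈ pairs Pᶜ, colSign q.2 * (wide M₀ i q * wide M₀ j q)
  have hfactor : (fiber.image fun M => block M P Finset.univ).card ≤ (fiber.image inner).card :=
    card_image_le_card_image_of_factors _ _ _ fun M hM N hN hMN =>
      block_univ_eq ((Finset.mem_filter.1 hM).2.trans (Finset.mem_filter.1 hN).2.symm) hMN
  have hinner : fiber.image inner ⊆ commutatorSolutions C' := by
    refine Finset.image_subset_iff.2 fun M hM => ?_
    obtain ⟨hMS, hblock⟩ := Finset.mem_filter.1 hM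
    convert submatrix_mem_commutatorSolutions (hS hMS) P using 2
    ext i j
    exact congrArg (C i j - ·) (Finset.sum_congr rfl fun q hq => by
      rw [block_eq_iff.1 hblock i i.2 q hq, block_eq_iff.1 hblock j j.2 q hq])
  exact (Nat.cast_le.2 (hfactor.trans (Finset.card_le_card hinner))).trans (hN C')

end Recursion

section RecursionBound

variable {ι : Type*} [Fintype ι] [LinearOrder ι] {C : Matrix ι ι ℝ} {S : Finset (Matrix ι ι ℝ)}
  {P K : Finset ι} {B : Finset (ι × Bool)} {ν : ι → WithTop ι}

theorem card_le_of_recursion (hS : S ⊆ commutatorSolutions C)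
    (H : ∀ M ∈ S, IsRankCertificate (wide M) P K B)
    (hν : ∀ M ∈ S, firstActive (wide M) P B = ν) (hne : S.Nonempty) {n h t N : ℝ}
    (hn : Fintype.card ι = n) (hh : K.card = h) (ht : Pᶜ.card = t)
    (hN : ∀ C' : Matrix P P ℝ, ((commutatorSolutions C').card : ℝ) ≤ N) :
    (S.card : ℝ) ≤ 2 ^ (n * h - h ^ 2 / 2 + 2 * n) * N := by
  obtain ⟨M₀, hM₀⟩ := hne
  have hs : ((singles P B).card : ℝ) + (doubles P B).card = t := by
    rw [← ht]
    exact_mod_cast card_singles_add_card_doubles P B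
  have hd : ((singles P B).card : ℝ) + 2 * (doubles P B).card = h := by
    rw [← hh]
    exact_mod_cast (H M₀ hM₀).card_rows
  have hP : P.card + t = n := by
    rw [← hn, ← ht]
    exact_mod_cast Finset.card_add_card_compl P
  have hhP : h ≤ P.card := hh ▸ Nat.cast_le.2 (Finset.card_le_card (H M₀ hM₀).rows_subset)
  have hN0 : 0 ≤ N := (Nat.cast_nonneg _).trans (hN 0)
  have houter := blockCount_outer_cols_le (hS.trans (commutatorSolutions_subset C)) H hν ⟨M₀, hM₀⟩
  have hrows := card_le_blockCount_rows hS H ⟨M₀, hM₀⟩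
  rw [hh] at houter
  rw [ht, hh] at hrows
  set s : ℝ := ((singles P B).card : ℝ)
  set d : ℝ := ((doubles P B).card : ℝ)
  calc (S.card : ℝ)
      ≤ 2 ^ ((2 * t - h) ^ 2 / 2 + h / 2) *
          (N * 2 ^ ((P.card : ℝ) * h + s * (1 + d) + d)) :=
        hrows.trans (mul_le_mul_of_nonneg_left ((blockCount_univ_le_mul hS P hN).trans
          (mul_le_mul_of_nonneg_left houter hN0)) (by positivity))
    _ = 2 ^ ((2 * t - h) ^ 2 / 2 + h / 2 + (P.card * h + s * (1 + d) + d)) * N := by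
        rw [mul_comm N, ← mul_assoc, ← Real.rpow_add two_pos]
    _ ≤ 2 ^ (n * h - h ^ 2 / 2 + 2 * n) * N := by
        refine mul_le_mul_of_nonneg_right
          (Real.rpow_le_rpow_of_exponent_le one_le_two ?_) hN0
        have hs0 : 0 ≤ s := Nat.cast_nonneg _
        have hd0 : 0 ≤ d := Nat.cast_nonneg _
        rw [eq_sub_of_add_eq hP] at hhP ⊢
        rw [← hs, ← hd] at hhP ⊢
        nlinarith

end RecursionBound

section Optimization

variable {n h t : ℝ}

theorem sq_sub_mul_le_or_recursion {c l : ℝ} (hn : 0 ≤ n) (ht : h ≤ 2 * t) (htn : t ≤ n)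
    (hh : h ≤ c * n) (hc : c ≤ 1) (hl : 0.303 ≤ l)
    (hcl : c - c ^ 2 / 2 + 0.698 * (1 - l) ^ 2 ≤ 0.698) :
    t ^ 2 - h * t ≤ (l * n) ^ 2 - h * (l * n) ∨
      (0.303 * n ≤ t ∧ n * h - h ^ 2 / 2 + 0.698 * (n - t) ^ 2 ≤ 0.698 * n ^ 2) := by
  rcases le_total t (l * n) with htl | hlt
  · exact .inl (by nlinarith)
  · refine .inr ⟨(mul_le_mul_of_nonneg_right hl hn).trans hlt, ?_⟩
    have hcn : c * n ≤ n := mul_le_of_le_one_left hn hc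
    have hrows : n * h - h ^ 2 / 2 ≤ (c - c ^ 2 / 2) * n ^ 2 := by
      nlinarith [mul_nonneg (sub_nonneg.2 hh) (by linarith : 0 ≤ n - (c * n + h) / 2)]
    have hinner : (n - t) ^ 2 ≤ (n - l * n) ^ 2 :=
      pow_le_pow_left₀ (sub_nonneg.2 htn) (sub_le_sub_left hlt n) 2
    calc n * h - h ^ 2 / 2 + 0.698 * (n - t) ^ 2
        ≤ (c - c ^ 2 / 2 + 0.698 * (1 - l) ^ 2) * n ^ 2 := by linarith
      _ ≤ 0.698 * n ^ 2 := mul_le_mul_of_nonneg_right hcl (sq_nonneg n)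

-- On each range of `h` the first alternative holds up to `t = l n`, the second one from there on.
theorem reveal_or_recursion_of_two_mul_le (ht : h ≤ 2 * t) (hth : t ≤ h) (hhn : 2 * h ≤ n) :
    3 * h * n - 3 * h ^ 2 + t ^ 2 - h * t ≤ 0.698 * n ^ 2 ∨
      (0.303 * n ≤ t ∧ n * h - h ^ 2 / 2 + 0.698 * (n - t) ^ 2 ≤ 0.698 * n ^ 2) := by
  have hn : 0 ≤ n := by linarith
  have htn : t ≤ n := by linarith
  rcases le_total h (0.4687 * n) with hle | hge
  · refine (sq_sub_mul_le_or_recursion (l := 0.303) hn ht htn hle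
      (by norm_num) (by norm_num) (by norm_num)).imp_left fun htl => ?_
    nlinarith [sq_nonneg (h - 0.4495 * n)]
  rcases le_total h (0.48 * n) with hle | hge'
  · refine (sq_sub_mul_le_or_recursion (l := 0.31) hn ht htn hle
      (by norm_num) (by norm_num) (by norm_num)).imp_left fun htl => ?_
    nlinarith [sq_nonneg (h - 0.4687 * n)]
  · refine (sq_sub_mul_le_or_recursion (c := 0.5) (l := 0.32) hn ht htn (by linarith)
      (by norm_num) (by norm_num) (by norm_num)).imp_left fun htl => ?_
    nlinarith [sq_nonneg (h - 0.48 * n)]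

theorem reveal_or_recursion_of_le_two_mul (hn : 0 ≤ n) (ht : h ≤ 2 * t) (htn : h + t ≤ n)
    (hhn : n ≤ 2 * h) :
    n ^ 2 - h * n + h ^ 2 + t ^ 2 - h * t ≤ 0.698 * n ^ 2 ∨
      (0.303 * n ≤ t ∧ n * h - h ^ 2 / 2 + 0.698 * (n - t) ^ 2 ≤ 0.698 * n ^ 2) := by
  have htn' : t ≤ n := by linarith
  have hle' : h ≤ 2 / 3 * n := by linarith
  rcases le_total h (0.55 * n) with hle | hge
  · refine (sq_sub_mul_le_or_recursion (l := 0.35) hn ht htn' hle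
      (by norm_num) (by norm_num) (by norm_num)).imp_left fun htl => ?_
    nlinarith [mul_nonneg (sub_nonneg.2 hhn) (sub_nonneg.2 hle)]
  · refine (sq_sub_mul_le_or_recursion (l := 0.4) hn ht htn' hle'
      (by norm_num) (by norm_num) (by norm_num)).imp_left fun htl => ?_
    nlinarith [mul_nonneg (sub_nonneg.2 hge) (sub_nonneg.2 hle')]

end Optimization

section Induction

/-- The error term in the exponent of the bound for the number of solutions. -/
noncomputable def errorTerm (n : ℕ) : ℝ := 24 * n * Real.logb 2 (n + 2)

theorem one_le_logb_add_two (n : ℕ) : 1 ≤ Real.logb 2 ((n : ℝ) + 2) := by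
  rw [Real.le_logb_iff_rpow_le one_lt_two (by positivity), Real.rpow_one]
  exact le_add_of_nonneg_left n.cast_nonneg

theorem errorTerm_le_mul {p n : ℕ} {c : ℝ} (hc : c ≤ 1) (hp : p ≤ c * n) :
    errorTerm p ≤ c * errorTerm n := by
  have hpn : (p : ℝ) ≤ n := hp.trans (mul_le_of_le_one_left n.cast_nonneg hc)
  have hlog : Real.logb 2 ((p : ℝ) + 2) ≤ Real.logb 2 ((n : ℝ) + 2) :=
    Real.logb_le_logb_of_le one_lt_two (by positivity) (by linarith)
  have hlog0 := zero_le_one.trans (one_le_logb_add_two n)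
  calc 24 * p * Real.logb 2 (p + 2) ≤ 24 * p * Real.logb 2 (n + 2) := by gcongr
    _ ≤ 24 * (c * n) * Real.logb 2 (n + 2) := by gcongr
    _ = c * errorTerm n := by rw [errorTerm]; ring

section RankCertificate

variable {ι : Type*} [Fintype ι] [DecidableEq ι] {P K : Finset ι} {B : Finset (ι × Bool)}

theorem IsRankCertificate.card_rows_le {W : Matrix ι (ι × Bool) ℝ}
    (H : IsRankCertificate W P K B) :
    Pᶜ.card ≤ K.card ∧ K.card ≤ 2 * Pᶜ.card ∧ K.card + Pᶜ.card ≤ Fintype.card ι := by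
  have hrows := H.card_rows
  have hcompl := card_singles_add_card_doubles P B
  have hle := Finset.card_le_card H.rows_subset
  have htotal := Finset.card_add_card_compl P
  omega

theorem card_le_or_recursion {C : Matrix ι ι ℝ} {S : Finset (Matrix ι ι ℝ)}
    (hS : S ⊆ commutatorSolutions C) (H : ∀ M ∈ S, IsRankCertificate (wide M) P K B)
    (hne : S.Nonempty) {n h t : ℝ} (hn : Fintype.card ι = n) (hh : K.card = h)
    (ht : Pᶜ.card = t) :
    (S.card : ℝ) ≤ 2 ^ (0.698 * n ^ 2 + n) ∨
      (0.303 * n ≤ t ∧ n * h - h ^ 2 / 2 + 0.698 * (n - t) ^ 2 ≤ 0.698 * n ^ 2) := by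
  obtain ⟨M₀, hM₀⟩ := hne
  obtain ⟨hth, hht, hhtn⟩ := (H M₀ hM₀).card_rows_le
  have hP := Finset.card_add_card_compl P
  have hreveal := fun x => card_le_of_reveal hS H ⟨M₀, hM₀⟩ hn hh ht (x := x)
  have hth' : t ≤ h := by rw [← ht, ← hh]; exact_mod_cast hth
  have hht' : h ≤ 2 * t := by rw [← ht, ← hh]; exact_mod_cast hht
  have hhtn' : h + t ≤ n := by rw [← ht, ← hh, ← hn]; exact_mod_cast hhtn
  rcases le_total (2 * K.card) (Fintype.card ι) with hle | hge
  · have hhn : 2 * h ≤ n := by rw [← hh, ← hn]; exact_mod_cast hle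
    refine (reveal_or_recursion_of_two_mul_le hht' hth' hhn).imp_left fun hexp => ?_
    refine (hreveal (Fintype.card ι - 2 * K.card) (by omega)).trans
      (Real.rpow_le_rpow_of_exponent_le one_le_two ?_)
    rw [Nat.cast_sub hle, Nat.cast_mul, Nat.cast_two, hn, hh]
    linarith
  · have hhn : n ≤ 2 * h := by rw [← hh, ← hn]; exact_mod_cast hge
    refine (reveal_or_recursion_of_le_two_mul (hn ▸ Nat.cast_nonneg _) hht' hhtn' hhn).imp_left
      fun hexp => ?_
    refine (hreveal 0 (by omega)).trans (Real.rpow_le_rpow_of_exponent_le one_le_two ?_)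
    rw [Nat.cast_zero]
    linarith

end RankCertificate

variable {ι : Type*} [Fintype ι] [LinearOrder ι]

theorem card_le_of_certificate [Nonempty ι] {C : Matrix ι ι ℝ} {S : Finset (Matrix ι ι ℝ)}
    {P K : Finset ι} {B : Finset (ι × Bool)} {ν : ι → WithTop ι}
    (hS : S ⊆ commutatorSolutions C) (H : ∀ M ∈ S, IsRankCertificate (wide M) P K B)
    (hν : ∀ M ∈ S, firstActive (wide M) P B = ν)
    (ih : P.card < Fintype.card ι → ∀ C' : Matrix P P ℝ,
      ((commutatorSolutions C').card : ℝ) ≤ 2 ^ (0.698 * (P.card : ℝ) ^ 2 + errorTerm P.card)) :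
    (S.card : ℝ) ≤ 2 ^ (0.698 * (Fintype.card ι : ℝ) ^ 2 + 2 * Fintype.card ι +
      0.697 * errorTerm (Fintype.card ι)) := by
  set n := Fintype.card ι
  have hn0 : (0 : ℝ) < n := Nat.cast_pos.2 Fintype.card_pos
  have hlog := one_le_logb_add_two n
  have herror : 0 ≤ errorTerm n := by unfold errorTerm; positivity
  rcases S.eq_empty_or_nonempty with rfl | hne
  · rw [Finset.card_empty, Nat.cast_zero]
    positivity
  rcases card_le_or_recursion hS H hne (n := n) rfl rfl rfl with hcard | ⟨ht, hexp⟩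
  · exact hcard.trans (Real.rpow_le_rpow_of_exponent_le one_le_two (by linarith))
  · have hP : (P.card : ℝ) + Pᶜ.card = n := by exact_mod_cast Finset.card_add_card_compl P
    have hPn : P.card < n := by
      rw [← @Nat.cast_lt ℝ]
      linarith
    have hP_error : errorTerm P.card ≤ 0.697 * errorTerm n :=
      errorTerm_le_mul (by norm_num) (by linarith)
    refine (card_le_of_recursion hS H hν hne (n := n) rfl rfl rfl (ih hPn)).trans ?_
    rw [← Real.rpow_add two_pos]
    rw [← eq_sub_of_add_eq hP] at hexp
    exact Real.rpow_le_rpow_of_exponent_le one_le_two (by linarith)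

/-- The possible values of a rank certificate `(P, K, B)` and of the first active indices. -/
abbrev Certificate (ι : Type*) := Finset ι × Finset ι × Finset (ι × Bool) × (ι → WithTop ι)

open Classical in
/-- The solutions of the commutator equation with a given rank certificate and given first
active indices. -/
noncomputable def certified (C : Matrix ι ι ℝ) (c : Certificate ι) : Finset (Matrix ι ι ℝ) :=
  (commutatorSolutions C).filter fun M =>
    IsRankCertificate (wide M) c.1 c.2.1 c.2.2.1 ∧ firstActive (wide M) c.1 c.2.2.1 = c.2.2.2

theorem mem_certified {C M : Matrix ι ι ℝ} {c : Certificate ι} :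
    M ∈ certified C c ↔ M ∈ commutatorSolutions C ∧
      IsRankCertificate (wide M) c.1 c.2.1 c.2.2.1 ∧
        firstActive (wide M) c.1 c.2.2.1 = c.2.2.2 := by
  classical
  exact Finset.mem_filter

theorem commutatorSolutions_subset_biUnion_certified [DecidableEq (Matrix ι ι ℝ)]
    (C : Matrix ι ι ℝ) :
    commutatorSolutions C ⊆ Finset.univ.biUnion (certified C) := by
  intro M hM
  obtain ⟨P, K, B, H⟩ := exists_isRankCertificate (wide M)
  exact Finset.mem_biUnion.2 ⟨(P, K, B, firstActive (wide M) P B), Finset.mem_univ _,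
    mem_certified.2 ⟨hM, H, rfl⟩⟩

theorem card_certificates_le (ι : Type*) [Fintype ι] [DecidableEq ι] :
    (Fintype.card (Certificate ι) : ℝ) ≤
      2 ^ (4 * Fintype.card ι + Fintype.card ι * Real.logb 2 (Fintype.card ι + 2)) := by
  set n := Fintype.card ι with hn
  have hcard : Fintype.card (Certificate ι) = 2 ^ (4 * n) * (n + 1) ^ n := by
    simp only [Certificate, Fintype.card_prod, Fintype.card_finset, Fintype.card_bool,
      Fintype.card_fun, ← hn]
    rw [show Fintype.card (WithTop ι) = n + 1 from Fintype.card_option]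
    ring
  have hlog : (2 : ℝ) ^ (n * Real.logb 2 (n + 2)) = (n + 2) ^ n := by
    rw [mul_comm, Real.rpow_mul zero_le_two, Real.rpow_logb two_pos (by norm_num) (by positivity),
      Real.rpow_natCast]
  have hpow : (2 : ℝ) ^ (4 * (n : ℝ)) = 2 ^ (4 * n) := by
    rw [← Real.rpow_natCast, Nat.cast_mul, Nat.cast_ofNat]
  rw [hcard, Real.rpow_add two_pos, hlog, hpow]
  push_cast
  gcongr
  norm_num

theorem card_le_of_certified_le {C : Matrix ι ι ℝ} {b : ℝ}
    (hb : ∀ c, ((certified C c).card : ℝ) ≤ 2 ^ b) :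
    ((commutatorSolutions C).card : ℝ) ≤
      2 ^ (4 * Fintype.card ι + Fintype.card ι * Real.logb 2 (Fintype.card ι + 2) + b) := by
  classical
  calc ((commutatorSolutions C).card : ℝ)
      ≤ ∑ c, ((certified C c).card : ℝ) := by
        exact_mod_cast (Finset.card_le_card (commutatorSolutions_subset_biUnion_certified C)).trans
          Finset.card_biUnion_le
    _ ≤ Fintype.card (Certificate ι) * 2 ^ b := by
        rw [← nsmul_eq_mul, ← Finset.card_univ]
        exact Finset.sum_le_card_nsmul _ _ _ fun c _ => hb c
    _ ≤ _ := by
        rw [Real.rpow_add two_pos]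
        gcongr
        exact card_certificates_le ι

theorem card_commutatorSolutions_le (C : Matrix ι ι ℝ) :
    ((commutatorSolutions C).card : ℝ) ≤
      2 ^ (0.698 * (Fintype.card ι : ℝ) ^ 2 + errorTerm (Fintype.card ι)) := by
  induction hn : Fintype.card ι using Nat.strong_induction_on generalizing ι with
  | _ n ih =>
    subst hn
    rcases isEmpty_or_nonempty ι with hι | hι
    · have hcard : (commutatorSolutions C).card ≤ 1 := Finset.card_le_one_of_subsingleton _
      simpa [errorTerm] using hcard
    refine (card_le_of_certified_le fun c => card_le_of_certificate
      (fun M hM => (mem_certified.1 hM).1) (fun M hM => (mem_certified.1 hM).2.1)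
      (fun M hM => (mem_certified.1 hM).2.2)
      fun hP C' => ih _ hP C' (Fintype.card_coe c.1)).trans
      (Real.rpow_le_rpow_of_exponent_le one_le_two ?_)
    have hlog := mul_le_mul_of_nonneg_left (one_le_logb_add_two (Fintype.card ι))
      (Nat.cast_nonneg (α := ℝ) (Fintype.card ι))
    unfold errorTerm
    linarith

end Induction

section Probability

theorem rademacherLaw_singleton {a : ℝ} (ha : a = 1 ∨ a = -1) : rademacherLaw {a} = 2⁻¹ := by
  rcases ha with rfl | rfl <;> simp [rademacherLaw] <;> norm_num

theorem ae_rademacherLaw : ∀ᵐ a ∂rademacherLaw, a = 1 ∨ a = -1 := by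
  simp [ae_iff, rademacherLaw]

theorem setOf_matrix_eq_biInter {Ω : Type*} {n : ℕ}
    (M : Ω → Matrix (Fin n) (Fin n) ℝ) (N : Matrix (Fin n) (Fin n) ℝ) :
    {ω | M ω = N} = ⋂ p ∈ (Finset.univ : Finset (Fin n × Fin n)),
      (fun ω => M ω p.1 p.2) ⁻¹' {N p.1 p.2} := by
  ext ω
  simp [← Matrix.ext_iff]

variable {Ω : Type*} [MeasurableSpace Ω] {n : ℕ} {M : Ω → Matrix (Fin n) (Fin n) ℝ} {μ : Measure Ω}

theorem IsRademacherMatrix.ae_mem_signMatrices (hM : IsRademacherMatrix M μ) :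
    ∀ᵐ ω ∂μ, M ω ∈ signMatrices (Fin n) := by
  simp only [mem_signMatrices, ae_all_iff]
  intro i j
  have hsign := ae_rademacherLaw
  rw [← (hM.law i j).map_eq] at hsign
  exact ae_of_ae_map (hM.law i j).aemeasurable hsign

theorem IsRademacherMatrix.measureReal_eq (hM : IsRademacherMatrix M μ)
    {N : Matrix (Fin n) (Fin n) ℝ} (hN : N ∈ signMatrices (Fin n)) :
    μ.real {ω | M ω = N} = 2 ^ (-(n : ℝ) ^ 2) := by
  have hentry : ∀ p : Fin n × Fin n, μ ((fun ω => M ω p.1 p.2) ⁻¹' {N p.1 p.2}) = 2⁻¹ :=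
    fun p => ((hM.law p.1 p.2).measure_eq (p := fun a => a = N p.1 p.2)
      (measurableSet_singleton _)).trans (rademacherLaw_singleton (mem_signMatrices.1 hN p.1 p.2))
  rw [measureReal_def, setOf_matrix_eq_biInter,
    hM.indep.measure_inter_preimage_eq_mul _ fun p _ => measurableSet_singleton _,
    Finset.prod_congr rfl fun p _ => hentry p, Finset.prod_const, Finset.card_univ,
    Fintype.card_prod, Fintype.card_fin, ENNReal.toReal_pow, ENNReal.toReal_inv,
    ENNReal.toReal_ofNat, inv_pow, Real.rpow_neg zero_le_two, ← Real.rpow_natCast, sq,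
    Nat.cast_mul]

theorem IsRademacherMatrix.measureReal_mem (hM : IsRademacherMatrix M μ)
    {S : Finset (Matrix (Fin n) (Fin n) ℝ)} (hS : S ⊆ signMatrices (Fin n)) :
    μ.real {ω | M ω ∈ S} = S.card * 2 ^ (-(n : ℝ) ^ 2) := by
  have : IsProbabilityMeasure μ := hM.indep.isProbabilityMeasure
  have hunion : {ω | M ω ∈ S} = ⋃ N ∈ S, {ω | M ω = N} := by
    ext ω
    simp
  have hdisjoint : (S : Set (Matrix (Fin n) (Fin n) ℝ)).Pairwise fun N N' =>
      AEDisjoint μ {ω | M ω = N} {ω | M ω = N'} := fun N _ N' _ hne =>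
    (Set.disjoint_left.2 fun ω hω hω' => hne (Eq.trans (Eq.symm hω) hω')).aedisjoint
  have hmeas : ∀ N ∈ S, NullMeasurableSet {ω | M ω = N} μ := fun N _ => by
    rw [setOf_matrix_eq_biInter]
    exact Finset.nullMeasurableSet_biInter _ fun p _ =>
      (hM.law p.1 p.2).aemeasurable.nullMeasurable (measurableSet_singleton _)
  rw [hunion, measureReal_biUnion_finset₀ hdisjoint hmeas,
    Finset.sum_congr rfl fun N hN => hM.measureReal_eq (hS hN), Finset.sum_const, nsmul_eq_mul]

theorem IsRademacherMatrix.measureReal_commutator (hM : IsRademacherMatrix M μ)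
    (C : Matrix (Fin n) (Fin n) ℝ) :
    μ.real {ω | M ω * (M ω)ᵀ = (M ω)ᵀ * M ω + C} =
      (commutatorSolutions C).card * 2 ^ (-(n : ℝ) ^ 2) := by
  rw [← hM.measureReal_mem (commutatorSolutions_subset C)]
  refine measureReal_congr ?_
  filter_upwards [hM.ae_mem_signMatrices] with ω hω
  exact propext ⟨fun h => mem_commutatorSolutions.2 ⟨hω, h⟩,
    fun h => (mem_commutatorSolutions.1 h).2⟩

theorem two_pow_choose_le_card_commutatorSolutions (ι : Type*) [Fintype ι] :
    2 ^ (Fintype.card ι + 1).choose 2 ≤ (commutatorSolutions (0 : Matrix ι ι ℝ)).card := by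
  classical
  set symmetric : (Sym2 ι → Bool) → Matrix ι ι ℝ :=
    fun g => Matrix.of fun i j => if g s(i, j) then 1 else -1
  have hmem : ∀ g, symmetric g ∈ commutatorSolutions 0 := fun g => by
    refine mem_commutatorSolutions.2 ⟨mem_signMatrices.2 fun i j => ite_eq_or_eq _ _ _, ?_⟩
    have hsymm : (symmetric g)ᵀ = symmetric g := by
      ext i j
      simp [symmetric, Sym2.eq_swap (a := j)]
    rw [hsymm, add_zero]
  have hinj : Function.Injective symmetric := fun g g' h => by
    funext z
    induction z with
    | _ i j =>
      have hij := congrFun₂ h i j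
      simp only [symmetric, Matrix.of_apply] at hij
      cases hg : g s(i, j) <;> cases hg' : g' s(i, j) <;>
        first | rfl | norm_num [hg, hg'] at hij
  calc 2 ^ (Fintype.card ι + 1).choose 2
      = (Finset.univ : Finset (Sym2 ι → Bool)).card := by
        rw [Finset.card_univ, Fintype.card_fun, Sym2.card, Fintype.card_bool]
    _ ≤ _ := Finset.card_le_card_of_injOn symmetric (fun g _ => hmem g) hinj.injOn

theorem tendsto_errorTerm_div_sq :
    Tendsto (fun n : ℕ => -(errorTerm n / (n : ℝ) ^ 2)) atTop (𝓝 0) := by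
  have hlog := (Real.tendsto_pow_log_div_mul_add_atTop 1 (-2) 1 one_ne_zero).comp
    (tendsto_atTop_add_const_right atTop (2 : ℝ) tendsto_natCast_atTop_atTop)
  have hneg := (hlog.const_mul (24 / Real.log 2)).neg
  rw [mul_zero, neg_zero] at hneg
  refine hneg.congr' ?_
  filter_upwards [eventually_ne_atTop 0] with n hn
  have hn0 : (n : ℝ) ≠ 0 := Nat.cast_ne_zero.2 hn
  have hshift : 1 * ((n : ℝ) + 2) + -2 = n := by ring
  simp only [Function.comp_apply, errorTerm, Real.logb, pow_one, hshift]
  field_simp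

theorem IsRademacherMatrix.measureReal_commutator_le (hM : IsRademacherMatrix M μ)
    (C : Matrix (Fin n) (Fin n) ℝ) :
    μ.real {ω | M ω * (M ω)ᵀ = (M ω)ᵀ * M ω + C} ≤
      2 ^ (-(0.302 + -(errorTerm n / (n : ℝ) ^ 2)) * (n : ℝ) ^ 2) := by
  have hcard := card_commutatorSolutions_le C
  have herror : errorTerm n / (n : ℝ) ^ 2 * (n : ℝ) ^ 2 = errorTerm n := by
    rcases eq_or_ne n 0 with rfl | hn
    · simp [errorTerm]
    · exact div_mul_cancel₀ _ (pow_ne_zero 2 (Nat.cast_ne_zero.2 hn))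
  rw [Fintype.card_fin] at hcard
  calc μ.real {ω | M ω * (M ω)ᵀ = (M ω)ᵀ * M ω + C}
      = (commutatorSolutions C).card * 2 ^ (-(n : ℝ) ^ 2) := hM.measureReal_commutator C
    _ ≤ 2 ^ (0.698 * (n : ℝ) ^ 2 + errorTerm n) * 2 ^ (-(n : ℝ) ^ 2) := by gcongr
    _ ≤ _ := by
      rw [← Real.rpow_add two_pos]
      exact Real.rpow_le_rpow_of_exponent_le one_le_two (by linarith)

theorem IsRademacherMatrix.le_measureReal_normal (hM : IsRademacherMatrix M μ) :
    (2 : ℝ) ^ (-0.5 * (n : ℝ) ^ 2) ≤ μ.real {ω | M ω * (M ω)ᵀ = (M ω)ᵀ * M ω} := by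
  have hcard := two_pow_choose_le_card_commutatorSolutions (Fin n)
  have hmeas := hM.measureReal_commutator 0
  rw [Fintype.card_fin] at hcard
  simp only [add_zero] at hmeas
  calc (2 : ℝ) ^ (-0.5 * (n : ℝ) ^ 2)
      ≤ 2 ^ (((n + 1).choose 2 : ℕ) + -(n : ℝ) ^ 2) := by
        refine Real.rpow_le_rpow_of_exponent_le one_le_two ?_
        rw [Nat.cast_choose_two]
        push_cast
        nlinarith [n.cast_nonneg (α := ℝ)]
    _ = ((2 ^ (n + 1).choose 2 : ℕ) : ℝ) * 2 ^ (-(n : ℝ) ^ 2) := by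
        rw [Real.rpow_add two_pos, Real.rpow_natCast, Nat.cast_pow, Nat.cast_two]
    _ ≤ _ := by
        rw [hmeas]
        gcongr

end Probability

theorem theorem1p1 :
    (∃ e : ℕ → ℝ, Tendsto e atTop (𝓝 0) ∧
      ∀ (n : ℕ) (C : Matrix (Fin n) (Fin n) ℝ)
        (Ω : Type*) [MeasurableSpace Ω] (μ : Measure Ω) [IsProbabilityMeasure μ]
        (M : Ω → Matrix (Fin n) (Fin n) ℝ), IsRademacherMatrix M μ →
        μ.real {ω | M ω * (M ω)ᵀ = (M ω)ᵀ * M ω + C}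
          ≤ (2 : ℝ) ^ (-(0.302 + e n) * (n : ℝ) ^ 2)) ∧
    (∃ e₁ e₂ : ℕ → ℝ, Tendsto e₁ atTop (𝓝 0) ∧ Tendsto e₂ atTop (𝓝 0) ∧
      ∀ (n : ℕ)
        (Ω : Type*) [MeasurableSpace Ω] (μ : Measure Ω) [IsProbabilityMeasure μ]
        (M : Ω → Matrix (Fin n) (Fin n) ℝ), IsRademacherMatrix M μ →
        (2 : ℝ) ^ (-(0.5 + e₁ n) * (n : ℝ) ^ 2)
          ≤ μ.real {ω | M ω * (M ω)ᵀ = (M ω)ᵀ * M ω} ∧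
        μ.real {ω | M ω * (M ω)ᵀ = (M ω)ᵀ * M ω}
          ≤ (2 : ℝ) ^ (-(0.302 + e₂ n) * (n : ℝ) ^ 2)) := by
  refine ⟨⟨_, tendsto_errorTerm_div_sq, fun n C Ω _ μ _ M hM => hM.measureReal_commutator_le C⟩,
    fun _ => 0, _, tendsto_const_nhds, tendsto_errorTerm_div_sq, fun n Ω _ μ _ M hM => ⟨?_, ?_⟩⟩
  · simpa only [add_zero] using hM.le_measureReal_normal
  · simpa only [add_zero] using hM.measureReal_commutator_le 0
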